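/- A unimodular lattice $\Lambda\subset\mathbb R^n$ is a full-rank lattice of determinant $\pm1$ with integral inner products; it is even if $\|x\|^2\in 2\mathbb Z$ for all $x\in\Lambda$, and odd otherwise. Its minimum is the least value of $\|x\|^2$ over nonzero $x\in\Lambda$, and its kissing number is the number of vectors attaining the minimum. An even unimodular lattice is extremal if its minimum is $2\lfloor n/24\rfloor+2$ (which is $4$ for $n=40$). Let $\Theta_\Lambda(z)=\sum_{x\in\Lambda}e^{\pi i\|x\|^2z}=\sum_{k\ge0}\#\{x\in\Lambda:\|x\|^2=k\}\,q^k$ with $q=e^{\pi iz}$, $\operatorname{Im} z>0$. The secrecy function of $\Lambda$ is $\Xi_\Lambda(y)=\Theta_{\mathbb Z^n}(yi)/\Theta_\Lambda(yi)$ for real $y>0$, and its secrecy gain is $\max_{y>0}\Xi_\Lambda(y)$. Let $E_4$ be the normalised Eisenstein series of weight $4$ and $\Delta=\eta^{24}$ the modular discriminant for $\mathrm{SL}_2(\mathbb Z)$. (1) Every extremal even unimodular lattice $\Lambda$ in dimension $40$ has theta function $\Theta_\Lambda=E_4^5-1200E_4^2\Delta$, minimum $4$ and kissing number $39600$; its secrecy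 function attains its maximum at $y=1$, and its secrecy gain is $\frac{4096}{297}$. (2) Every odd unimodular lattice $\Lambda$ in dimension $40$ whose theta series has the form $1+39600q^4+1048576q^5+\cdots$ has minimum $4$ and kissing number $39600$; its secrecy function attains its maximum at $y=1$, and its secrecy gain is $\frac{4096}{301}$. (3) Lattices as in (1) and as in (2) exist. Hence there are two unimodular lattices in dimension $40$, one even and one odd, with the same minimum and the same kissing number but different secrecy gains. -/

import Mathlib

noncomputable section

namespace SecrecyGain

/-- Euclidean space of dimension `n`. -/
abbrev Euc (n : ℕ) : Type := EuclideanSpace ℝ (Fin n)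

/-- The lattice of integer vectors. -/
def intLattice (n : ℕ) : Submodule ℤ (Euc n) :=
  Submodule.span ℤ (Set.range (EuclideanSpace.basisFun (Fin n) ℝ))

/-- A unimodular lattice: a full-rank lattice, with integral inner products, whose determinant is
`±1` (that is, the covolume, the absolute value of the determinant of a generator matrix,
equals one). -/
structure IsUnimodular {n : ℕ} (Λ : Submodule ℤ (Euc n)) : Prop where
  discrete : DiscreteTopology Λ
  full : IsZLattice ℝ Λ
  integral : ∀ x ∈ Λ, ∀ y ∈ Λ, ∃ k : ℤ, inner ℝ x y = (k : ℝ)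
  covolume_eq_one : ZLattice.covolume Λ = 1

/-- All squared lengths are even integers. -/
def IsEven {n : ℕ} (Λ : Submodule ℤ (Euc n)) : Prop :=
  ∀ x ∈ Λ, ∃ k : ℤ, ‖x‖ ^ 2 = 2 * (k : ℝ)

/-- An even unimodular lattice. -/
def IsEvenUnimodular {n : ℕ} (Λ : Submodule ℤ (Euc n)) : Prop :=
  IsUnimodular Λ ∧ IsEven Λ

/-- An odd unimodular lattice: a unimodular lattice that is not even. -/
def IsOddUnimodular {n : ℕ} (Λ : Submodule ℤ (Euc n)) : Prop :=
  IsUnimodular Λ ∧ ¬ IsEven Λ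

/-- The minimum of a lattice: the least squared length of a nonzero vector. -/
def minNorm {n : ℕ} (Λ : Submodule ℤ (Euc n)) : ℝ :=
  sInf {r : ℝ | ∃ x ∈ Λ, x ≠ 0 ∧ r = ‖x‖ ^ 2}

/-- The kissing number: the number of shortest nonzero vectors. -/
def kissingNumber {n : ℕ} (Λ : Submodule ℤ (Euc n)) : ℕ :=
  Set.ncard {x : Euc n | x ∈ Λ ∧ x ≠ 0 ∧ ‖x‖ ^ 2 = minNorm Λ}

/-- An extremal even unimodular lattice: the minimum is `2 ⌊n / 24⌋ + 2`. -/
def IsExtremalEven {n : ℕ} (Λ : Submodule ℤ (Euc n)) : Prop :=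
  IsEvenUnimodular Λ ∧ minNorm Λ = ((2 * (n / 24) + 2 : ℕ) : ℝ)

/-- The theta function `Θ_Λ(z) = ∑_{x ∈ Λ} exp(π i ‖x‖² z)`. -/
def theta {n : ℕ} (Λ : Submodule ℤ (Euc n)) (z : ℂ) : ℂ :=
  ∑' x : Λ, Complex.exp (Real.pi * Complex.I * ((‖(x : Euc n)‖ ^ 2 : ℝ) : ℂ) * z)

/-- The theta series of an integral lattice as a power series in `q = exp(π i z)`: the coefficient
of `q ^ k` is the number of lattice vectors of squared length `k`. -/
def thetaSeries {n : ℕ} (Λ : Submodule ℤ (Euc n)) : PowerSeries ℤ :=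
  PowerSeries.mk fun k => (Set.ncard {x : Euc n | x ∈ Λ ∧ ‖x‖ ^ 2 = (k : ℝ)} : ℤ)

/-- The secrecy function `Ξ_Λ(y) = Θ_{ℤⁿ}(y i) / Θ_Λ(y i)`; the quotient is a real number, see
`ofReal_secrecyFunction`. -/
def secrecyFunction {n : ℕ} (Λ : Submodule ℤ (Euc n)) (y : ℝ) : ℝ :=
  (theta (intLattice n) (y * Complex.I) / theta Λ (y * Complex.I)).re

/-- The secrecy gain: the maximum of the secrecy function over all `y > 0`. -/
def secrecyGain {n : ℕ} (Λ : Submodule ℤ (Euc n)) : ℝ :=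
  sSup (secrecyFunction Λ '' Set.Ioi 0)

theorem theta_mul_I {n : ℕ} (Λ : Submodule ℤ (Euc n)) (y : ℝ) :
    theta Λ (y * Complex.I) =
      ((∑' x : Λ, Real.exp (-Real.pi * ‖(x : Euc n)‖ ^ 2 * y) : ℝ) : ℂ) := by
  rw [theta, Complex.ofReal_tsum]
  refine tsum_congr fun x => ?_
  rw [Complex.ofReal_exp]
  congr 1
  push_cast
  linear_combination (Real.pi * ((‖(x : Euc n)‖ : ℝ) : ℂ) ^ 2 * y) * Complex.I_sq

theorem ofReal_secrecyFunction {n : ℕ} (Λ : Submodule ℤ (Euc n)) (y : ℝ) :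
    (secrecyFunction Λ y : ℂ) =
      theta (intLattice n) (y * Complex.I) / theta Λ (y * Complex.I) := by
  rw [secrecyFunction, theta_mul_I, theta_mul_I, ← Complex.ofReal_div, Complex.ofReal_re]

end SecrecyGain

end

noncomputable section

open UpperHalfPlane Filter Topology Asymptotics Real
open scoped Manifold MatrixGroups ModularForm

namespace SecrecyGain

/-! Modularity determines the theta function of such a lattice, and on the imaginary axis the
secrecy function becomes one over a quintic polynomial in a single real variable.

Poisson summation (`IsUnimodular.poisson`) makes the theta function of a unimodular lattice of rank
40 a form of weight 20 for the theta group, and for SL(2, ℤ) if the lattice is even. A level-one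
form of weight k vanishing to order m > k/12 at infinity is zero (`eq_zero_of_isBigO`: divide by Δ^m
and land in negative weight). In the even case the coefficients of norms 0 and 2 therefore decide
everything. In the odd case `eq_zero_of_thetaGroup` multiplies the three conjugates of a theta-group
form into a level-one form, so the coefficients of norms 0 to 5 suffice, provided the form is
bounded at the cusp 1. That boundedness holds because the conjugate of the theta function there is a
theta sum over a translate of the lattice. The result is Θ = E₄⁵ - 1200 E₄²Δ + c (θ₂θ₄)²⁰, with c =
0 (even) or c = 1 (odd).

Jacobi's identity θ₃⁴ = θ₂⁴ + θ₄⁴ with `E₄_eq_theta` and `discriminant_eq_theta` turns Θ/θ₃⁴⁰ into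
`gainPoly c u` with u = θ₂⁴θ₄⁴/θ₃⁸. On the imaginary axis 0 ≤ u ≤ 1/4, and u = 1/4 at y = 1, the
fixed point of S. Since `gainPoly c` is smallest at 1/4 (`gainPoly_quarter_le`), the gain is
4096/(297 + 4c).

Existence: a doubly even self-dual double circulant code of length 40 and minimum weight 8 gives a
lattice of integer vectors scaled by 1/√8, completed to a unimodular lattice by a glue vector g ≡ 1
mod 4. The all-ones vector gives an odd lattice; changing one coordinate to -3 gives an even one.
Glue cosets with odd coordinates have norm at least 5, so both lattices have the same vectors of
norm below 5 (`setOf_norm_sq_eq`). The count 39600, which modular forms supply for the even lattice,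
thus passes to the odd one, whose norm-5 vectors correspond to the 2²⁰ codewords. -/

/-- The exponential sum `∑ aᵢ exp(π i kᵢ τ)` on the upper half plane. -/
def expSum {ι : Type*} (a : ι → ℂ) (k : ι → ℝ) (τ : ℍ) : ℂ :=
  ∑' i, a i * Complex.exp (π * Complex.I * k i * τ)

/-! ### Exponential sums: holomorphy and asymptotics at infinity -/

section ExpSum

variable {ι : Type*} {a : ι → ℂ} {k : ι → ℝ}

lemma norm_expSum_term_le (ha : ∀ i, ‖a i‖ ≤ 1) (z : ℂ) (i : ι) :
    ‖a i * Complex.exp (π * Complex.I * k i * z)‖ ≤ rexp (-π * k i * z.im) := by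
  rw [norm_mul, Complex.norm_exp]
  have : (π * Complex.I * k i * z).re = -π * k i * z.im := by simp
  rw [this]
  exact mul_le_of_le_one_left (Real.exp_pos _).le (ha i)

lemma summable_expSum_term (ha : ∀ i, ‖a i‖ ≤ 1)
    (hs : ∀ y : ℝ, 0 < y → Summable fun i => rexp (-π * k i * y)) (τ : ℍ) :
    Summable fun i => a i * Complex.exp (π * Complex.I * k i * τ) :=
  .of_norm_bounded (hs τ.im τ.im_pos) (norm_expSum_term_le ha τ)

lemma mdifferentiable_expSum (ha : ∀ i, ‖a i‖ ≤ 1) (hk : ∀ i, 0 ≤ k i)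
    (hs : ∀ y : ℝ, 0 < y → Summable fun i => rexp (-π * k i * y)) :
    MDiff (expSum a k) := by
  rw [UpperHalfPlane.mdifferentiable_iff]
  intro z (hz : 0 < z.im)
  have hz2 : 0 < z.im / 2 := by positivity
  have hopen : IsOpen {w : ℂ | z.im / 2 < w.im} := isOpen_lt continuous_const Complex.continuous_im
  have hmem : {w : ℂ | z.im / 2 < w.im} ∈ 𝓝 z := hopen.mem_nhds (by simp [hz])
  have hd : DifferentiableOn ℂ
      (fun w => ∑' i, a i * Complex.exp (π * Complex.I * k i * w)) {w : ℂ | z.im / 2 < w.im} := by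
    refine Complex.differentiableOn_tsum_of_summable_norm (hs _ hz2)
      (fun i => by fun_prop) hopen fun i w hw => (norm_expSum_term_le ha w i).trans ?_
    have := mul_le_mul_of_nonneg_left (le_of_lt hw) (mul_nonneg pi_pos.le (hk i))
    exact Real.exp_le_exp.2 (by
      have : z.im / 2 < w.im := hw
      linarith)
  have : DifferentiableAt ℂ (expSum a k ∘ ofComplex) z := by
    refine (hd.differentiableAt hmem).congr_of_eventuallyEq ?_
    filter_upwards [hmem] with w hw
    have hw' : 0 < w.im := hz2.trans hw
    simp [expSum, ofComplex_apply_of_im_pos hw']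
  exact this.differentiableWithinAt

/-- For k ≥ N and y ≥ 1, exp(-πky) ≤ exp(-πN(y-1)) exp(-πk), so the tail is controlled by the
convergent sum at height 1. -/
lemma expSum_sub_sum_isBigO (ha : ∀ i, ‖a i‖ ≤ 1)
    (hs : ∀ y : ℝ, 0 < y → Summable fun i => rexp (-π * k i * y))
    (s : Finset ι) {N : ℝ} (hN : ∀ i, i ∉ s → N ≤ k i) :
    (fun τ => expSum a k τ - ∑ i ∈ s, a i * Complex.exp (π * Complex.I * k i * τ))
      =O[atImInfty] fun τ => rexp (-π * N * τ.im) := by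
  refine .of_bound (rexp (π * N) * ∑' i, rexp (-π * k i * 1)) ?_
  have h1 : ∀ᶠ τ : ℍ in atImInfty, 1 ≤ τ.im :=
    (atImInfty_mem _).2 ⟨1, fun z hz => hz⟩
  filter_upwards [h1] with τ hτ
  have hsum := summable_expSum_term ha hs τ
  have hs1 := hs 1 one_pos
  rw [expSum, ← hsum.sum_add_tsum_compl (s := s), add_sub_cancel_left]
  have hb : ∀ i : ↥((s : Set ι)ᶜ), ‖a i * Complex.exp (π * Complex.I * k i * τ)‖ ≤
      rexp (-π * N * (τ.im - 1)) * rexp (-π * k i * 1) := by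
    intro i
    refine (norm_expSum_term_le ha τ i).trans ?_
    rw [← Real.exp_add]
    gcongr
    have := mul_le_mul_of_nonneg_left (hN i (fun h => i.2 (Finset.mem_coe.2 h)))
      (mul_nonneg pi_pos.le (sub_nonneg.2 hτ))
    change -π * k i * τ.im ≤ _
    nlinarith
  have hs2 : Summable fun i : ↥((s : Set ι)ᶜ) =>
      rexp (-π * N * (τ.im - 1)) * rexp (-π * k i * 1) :=
    (hs1.subtype _).mul_left _
  refine (tsum_of_norm_bounded hs2.hasSum hb).trans ?_
  rw [tsum_mul_left, Real.norm_of_nonneg (Real.exp_pos _).le]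
  have h2 : ∑' i : ↥((s : Set ι)ᶜ), rexp (-π * k i * 1) ≤ ∑' i, rexp (-π * k i * 1) :=
    hs1.tsum_subtype_le _ _ (fun _ => (Real.exp_pos _).le)
  have h3 : rexp (-π * N * (τ.im - 1)) = rexp (π * N) * rexp (-π * N * τ.im) := by
    rw [← Real.exp_add]; ring_nf
  rw [h3]
  have := mul_le_mul_of_nonneg_left h2
    (mul_pos (Real.exp_pos (π * N)) (Real.exp_pos (-π * N * τ.im))).le
  linarith

lemma expSum_isBigO_one (ha : ∀ i, ‖a i‖ ≤ 1) (hk : ∀ i, 0 ≤ k i)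
    (hs : ∀ y : ℝ, 0 < y → Summable fun i => rexp (-π * k i * y)) :
    IsBoundedAtImInfty (expSum a k) := by
  simpa [IsBoundedAtImInfty, BoundedAtFilter, Pi.one_def] using
    expSum_sub_sum_isBigO ha hs ∅ (N := 0) (fun i _ => hk i)

end ExpSum

/-- Since exp t ≥ t^j / j!, the Gaussian is dominated by an inverse power of the norm, which is
summable once the exponent exceeds the rank. -/
lemma summable_exp_neg_mul_norm_add_sq {n : ℕ} (Λ : Submodule ℤ (Euc n)) [DiscreteTopology Λ]
    (x : Euc n) {c : ℝ} (hc : 0 < c) :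
    Summable fun v : Λ => rexp (-c * ‖(v : Euc n) + x‖ ^ 2) := by
  set j := Module.finrank ℤ Λ + 1
  have h := (ZLattice.summable_norm_sub_inv_pow Λ (2 * j) (by omega) (-x)).mul_left
    ((j.factorial : ℝ) / c ^ j)
  -- At v = -x the inverse power evaluates to 0 while the Gaussian is 1, so the comparison is made
  -- off this one point.
  refine Summable.of_norm_bounded_eventually h ?_
  have hfin : {v : Λ | ¬ (v : Euc n) + x ≠ 0}.Finite := by
    refine Set.Subsingleton.finite fun v hv w hw => ?_
    simp only [ne_eq, not_not] at hv hw
    exact Subtype.ext (add_right_cancel (hv.trans hw.symm))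
  filter_upwards [show {v : Λ | (v : Euc n) + x ≠ 0} ∈ cofinite from hfin] with v hv
  have hpos : 0 < ‖(v : Euc n) + x‖ := norm_pos_iff.2 hv
  have hle := Real.pow_div_factorial_le_exp (c * ‖(v : Euc n) + x‖ ^ 2) (by positivity) j
  rw [Real.norm_of_nonneg (Real.exp_pos _).le, neg_mul, Real.exp_neg, sub_neg_eq_add,
    inv_le_comm₀ (Real.exp_pos _) (by positivity)]
  refine le_trans (le_of_eq ?_) hle
  rw [mul_pow, ← pow_mul]
  field_simp
  rw [← mul_pow, one_div_mul_cancel hpos.ne', one_pow]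

/-! ### Poisson summation over ℤⁿ through Fourier series on the torus -/

section Poisson

open MeasureTheory

variable {ι : Type*} [Fintype ι]

/-- The additive character `x ↦ exp(2 π i ∑ nᵢ xᵢ)`. -/
def eChar (n : ι → ℤ) (x : ι → ℝ) : ℂ :=
  Complex.exp (2 * π * Complex.I * ((∑ i, (n i : ℝ) * x i : ℝ) : ℂ))

lemma mFourier_coe (n : ι → ℤ) (x : ι → ℝ) :
    UnitAddTorus.mFourier n (fun i => (x i : UnitAddCircle)) = eChar n x := by
  simp only [UnitAddTorus.mFourier, ContinuousMap.coe_mk, fourier_coe_apply, eChar]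
  rw [← Complex.exp_sum]
  congr 1
  push_cast
  rw [Finset.mul_sum]
  refine Finset.sum_congr rfl fun i _ => by simp; ring

lemma norm_eChar (n : ι → ℤ) (x : ι → ℝ) : ‖eChar n x‖ = 1 := by
  rw [eChar, Complex.norm_exp]
  simp

lemma continuous_eChar (n : ι → ℤ) : Continuous (eChar n) := by
  unfold eChar
  fun_prop

lemma eChar_add_int (n : ι → ℤ) (x : ι → ℝ) (m : ι → ℤ) :
    eChar n (x + fun i => (m i : ℝ)) = eChar n x := by
  simp only [eChar, Pi.add_apply, mul_add, Finset.sum_add_distrib]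
  push_cast
  rw [mul_add, Complex.exp_add]
  have : (2 * π * Complex.I * ∑ i, (n i : ℂ) * (m i : ℂ)) =
      ((∑ i, n i * m i : ℤ) : ℂ) * (2 * π * Complex.I) := by push_cast; ring
  rw [this, Complex.exp_int_mul_two_pi_mul_I, mul_one]

variable {g : (ι → ℝ) → ℂ}

lemma continuous_tsum_translates (hg : Continuous g)
    (hloc : ∀ R : ℝ, ∃ u : (ι → ℤ) → ℝ, Summable u ∧
      ∀ m x, ‖x‖ ≤ R → ‖g (x + fun i => (m i : ℝ))‖ ≤ u m) :
    Continuous fun x => ∑' m : ι → ℤ, g (x + fun i => (m i : ℝ)) := by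
  rw [continuous_iff_continuousAt]
  intro x
  obtain ⟨u, hu, hb⟩ := hloc (‖x‖ + 1)
  have hc : ContinuousOn (fun x => ∑' m : ι → ℤ, g (x + fun i => (m i : ℝ)))
      (Metric.closedBall 0 (‖x‖ + 1)) :=
    continuousOn_tsum (fun m => by fun_prop) hu fun m y hy => hb m y (by simpa using hy)
  refine hc.continuousAt (Filter.mem_of_superset (Metric.ball_mem_nhds x one_pos) ?_)
  intro y hy
  rw [Metric.mem_ball, dist_eq_norm] at hy
  rw [mem_closedBall_zero_iff]
  have := norm_le_norm_add_norm_sub' y x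
  linarith

/-- Unfolding: the integer translates of the half-open unit cube tile the space. -/
lemma integral_unitBox_tsum_translates {h : (ι → ℝ) → ℂ} (hint : Integrable h)
    {u : (ι → ℤ) → ℝ} (hu : Summable u)
    (hb : ∀ m x, ‖x‖ ≤ 1 → ‖h (x + fun i => (m i : ℝ))‖ ≤ u m) :
    ∫ x in {x : ι → ℝ | ∀ i, x i ∈ Set.Ioc (0 : ℝ) (0 + 1)},
      ∑' m : ι → ℤ, h (x + fun i => (m i : ℝ)) = ∫ x, h x := by
  set S : Set (ι → ℝ) := {x | ∀ i, x i ∈ Set.Ioc (0 : ℝ) (0 + 1)} with hS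
  set T : (ι → ℤ) → Set (ι → ℝ) := fun m => {x | ∀ i, x i ∈ Set.Ioc (m i : ℝ) (m i + 1)} with hT
  have hSm : MeasurableSet S := MeasurableSet.univ_pi' fun i => measurableSet_Ioc
  have hTm : ∀ m, MeasurableSet (T m) := fun m => MeasurableSet.univ_pi' fun i => measurableSet_Ioc
  have hpre : ∀ m : ι → ℤ, (fun x : ι → ℝ => x + fun i => (m i : ℝ)) ⁻¹' T m = S := by
    intro m
    ext x
    simp only [hT, hS, Set.mem_preimage, Set.mem_ofPred_eq, Pi.add_apply, Set.mem_Ioc]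
    refine forall_congr' fun i => ?_
    constructor <;> rintro ⟨h1, h2⟩ <;> constructor <;> linarith
  have htrans : ∀ m : ι → ℤ,
      ∫ x in S, h (x + fun i => (m i : ℝ)) = ∫ x in T m, h x := by
    intro m
    rw [← hpre m]
    exact (measurePreserving_add_right volume _).setIntegral_preimage_emb
      (measurableEmbedding_addRight _) h (T m)
  have hvol : volume S < ⊤ := by
    have : S = Set.pi Set.univ fun _ : ι => Set.Ioc (0 : ℝ) (0 + 1) := by ext; simp [hS]
    rw [this, volume_pi_pi]
    simp
  have hnorm : ∀ x ∈ S, ‖x‖ ≤ 1 := by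
    intro x hx
    refine (pi_norm_le_iff_of_nonneg zero_le_one).2 fun i => ?_
    have := hx i
    simp only [Set.mem_Ioc, zero_add] at this
    rw [Real.norm_of_nonneg this.1.le]
    exact this.2
  have hintm : ∀ m : ι → ℤ, IntegrableOn (fun x => h (x + fun i => (m i : ℝ))) S :=
    fun m => (hint.comp_add_right _).integrableOn
  rw [← integral_tsum_of_summable_integral_norm hintm]
  · simp_rw [htrans]
    have hU : (⋃ m, T m) = Set.univ := by
      refine Set.eq_univ_of_forall fun x => Set.mem_iUnion.2 ⟨fun i => ⌈x i⌉ - 1, fun i => ?_⟩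
      simp only [Set.mem_Ioc]
      push_cast
      constructor
      · linarith [Int.ceil_lt_add_one (x i)]
      · linarith [Int.le_ceil (x i)]
    have hd : Pairwise (Function.onFun Disjoint T) := by
      intro m m' hmm
      refine Set.disjoint_left.2 fun x hx hx' => hmm (funext fun i => ?_)
      have h1 := hx i
      have h2 := hx' i
      simp only [Set.mem_Ioc] at h1 h2
      have h3 : (m i : ℝ) < m' i + 1 := by linarith
      have h4 : (m' i : ℝ) < m i + 1 := by linarith
      have h3' : m i < m' i + 1 := by exact_mod_cast h3
      have h4' : m' i < m i + 1 := by exact_mod_cast h4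
      omega
    have := (hasSum_integral_iUnion hTm hd (f := h) (μ := volume) hint.integrableOn).tsum_eq
    rw [this, hU, Measure.restrict_univ]
  · refine Summable.of_nonneg_of_le (fun m => integral_nonneg fun x => norm_nonneg _)
      (fun m => ?_) (hu.mul_right (volume.real S))
    have := norm_setIntegral_le_of_norm_le_const hvol (f := fun x => ‖h (x + fun i => (m i : ℝ))‖)
      (C := u m) (fun x hx => by rw [norm_norm]; exact hb m x (hnorm x hx))
    exact (le_abs_self _).trans this

/-- The periodisation of g descends to a continuous function on the torus, and unfolding identifies
its Fourier coefficients with values of the Fourier transform of g. Summability of these gives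
pointwise convergence of the Fourier series. -/
theorem tsum_translates_eq_tsum_fourier (hg : Continuous g) (hint : Integrable g)
    (hloc : ∀ R : ℝ, ∃ u : (ι → ℤ) → ℝ, Summable u ∧
      ∀ m x, ‖x‖ ≤ R → ‖g (x + fun i => (m i : ℝ))‖ ≤ u m)
    (hsum : Summable fun n : ι → ℤ => ∫ x, eChar (-n) x * g x) (x : ι → ℝ) :
    ∑' m : ι → ℤ, g (x + fun i => (m i : ℝ)) =
      ∑' n : ι → ℤ, (∫ y, eChar (-n) y * g y) * eChar n x := by
  set F : (ι → ℝ) → ℂ := fun x => ∑' m : ι → ℤ, g (x + fun i => (m i : ℝ)) with hF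
  have hFc : Continuous F := continuous_tsum_translates hg hloc
  have hper : ∀ (x : ι → ℝ) (k : ι → ℤ), F (x + fun i => (k i : ℝ)) = F x := by
    intro x k
    simp only [hF]
    rw [← (Equiv.addLeft k).tsum_eq fun m : ι → ℤ => g (x + fun i => (m i : ℝ))]
    refine tsum_congr fun m => ?_
    congr 1
    ext i
    simp [add_assoc]
  set G : UnitAddTorus ι → ℂ := fun t => F fun i => (t i).out with hG
  have hGF : ∀ x : ι → ℝ, G (fun i => (x i : UnitAddCircle)) = F x := by
    intro x
    have : ∀ i, ∃ k : ℤ, x i + k = ((x i : UnitAddCircle)).out := by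
      intro i
      have h1 : ((((x i : UnitAddCircle)).out : ℝ) : UnitAddCircle) = (x i : UnitAddCircle) :=
        Quotient.out_eq _
      have h2 : (((x i : UnitAddCircle).out - x i : ℝ) : UnitAddCircle) = 0 := by
        rw [AddCircle.coe_sub, h1, sub_self]
      obtain ⟨k, hk⟩ := (AddCircle.coe_eq_zero_iff 1).1 h2
      refine ⟨k, ?_⟩
      simp at hk
      linarith
    choose k hk using this
    rw [← hper x k]
    exact congrArg F (funext fun i => (hk i).symm)
  have hq : IsOpenQuotientMap (Pi.map fun (_ : ι) (x : ℝ) => (x : UnitAddCircle)) :=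
    IsOpenQuotientMap.piMap fun _ => QuotientAddGroup.isOpenQuotientMap_mk
  have hGc : Continuous G := by
    rw [hq.isQuotientMap.continuous_iff]
    exact hFc.congr fun x => (hGF x).symm
  set G' : C(UnitAddTorus ι, ℂ) := ⟨G, hGc⟩
  obtain ⟨u, hu, hb⟩ := hloc 1
  have hcoeff : ∀ n, UnitAddTorus.mFourierCoeff G' n = ∫ y, eChar (-n) y * g y := by
    intro n
    rw [UnitAddTorus.mFourierCoeff_eq_integral _ n 0]
    simp only [mFourier_coe, Pi.zero_apply]
    have hc : Continuous (eChar (-n)) := continuous_eChar _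
    rw [← integral_unitBox_tsum_translates (h := fun y => eChar (-n) y * g y) (u := u)
      (hint.bdd_mul hc.aestronglyMeasurable (Eventually.of_forall fun y => (norm_eChar _ y).le))
      hu (fun m y hy => by rw [norm_mul, norm_eChar, one_mul]; exact hb m y hy)]
    congr 1
    ext y
    simp only [eChar_add_int, tsum_mul_left, smul_eq_mul]
    congr 1
    exact hGF y
  have := UnitAddTorus.hasSum_mFourier_series_apply_of_summable (f := G')
    (by simpa only [funext hcoeff] using hsum) (fun i => (x i : UnitAddCircle))
  simp only [hcoeff, mFourier_coe, smul_eq_mul] at this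
  rw [this.tsum_eq]
  exact (hGF x).symm

end Poisson

/-! ### Gram matrices, covolume and self-duality -/

section Gram

open MeasureTheory

variable {n : ℕ} {Λ : Submodule ℤ (Euc n)}

/-- The Gram matrix is MᵀM, where M holds the coordinates of the basis in an orthonormal basis. -/
lemma covolume_sq_eq_det_gram [DiscreteTopology Λ] [IsZLattice ℝ Λ]
    (b : Module.Basis (Fin n) ℤ Λ) :
    ZLattice.covolume Λ ^ 2 =
      (Matrix.of fun i j => inner ℝ (b i : Euc n) (b j : Euc n)).det := by
  set e := EuclideanSpace.basisFun (Fin n) ℝ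
  have h1 : volume.real (ZSpan.fundamentalDomain e.toBasis) = 1 := by
    rw [measureReal_congr (ZSpan.fundamentalDomain_ae_parallelepiped _ _), measureReal_def]
    simp [OrthonormalBasis.volume_parallelepiped]
  rw [ZLattice.covolume_eq_det_mul_measureReal Λ volume b e.toBasis, h1, mul_one, sq_abs,
    Module.Basis.det_apply, sq]
  nth_rw 1 [← Matrix.det_transpose]
  rw [← Matrix.det_mul]
  congr 1
  ext i j
  simp only [Matrix.mul_apply, Matrix.transpose_apply, Module.Basis.toMatrix_apply,
    OrthonormalBasis.coe_toBasis_repr_apply, Function.comp_apply, Matrix.of_apply]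
  rw [← e.sum_inner_mul_inner]
  simp [e.repr_apply_apply, real_inner_comm]

lemma exists_basis (Λ : Submodule ℤ (Euc n)) [DiscreteTopology Λ] [IsZLattice ℝ Λ] :
    Nonempty (Module.Basis (Fin n) ℤ Λ) := by
  have : Module.Finite ℤ Λ := ZLattice.module_finite ℝ Λ
  have : Module.Free ℤ Λ := ZLattice.module_free ℝ Λ
  have h : Module.finrank ℤ Λ = n := by rw [ZLattice.rank ℝ]; simp
  exact ⟨Module.finBasisOfFinrankEq ℤ Λ h⟩

lemma coe_eq_sum_repr_smul (b : Module.Basis (Fin n) ℤ Λ) (w : Λ) :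
    (w : Euc n) = ∑ j, (b.repr w j : ℝ) • (b j : Euc n) := by
  have h := congrArg (Subtype.val : Λ → Euc n) (b.sum_repr w)
  refine h.symm.trans ?_
  rw [AddSubmonoidClass.coe_finsetSum]
  exact Finset.sum_congr rfl fun i _ => by rw [Submodule.coe_smul, Int.cast_smul_eq_zsmul]

/-- Pairing with the vectors of a basis identifies a unimodular lattice with `ℤⁿ`. -/
lemma IsUnimodular.exists_dual_equiv (hΛ : IsUnimodular Λ) (b : Module.Basis (Fin n) ℤ Λ) :
    ∃ φ : Λ ≃ (Fin n → ℤ), ∀ w i, (φ w i : ℝ) = inner ℝ (w : Euc n) (b i : Euc n) := by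
  have := hΛ.discrete
  have := hΛ.full
  choose G hG using fun i j => hΛ.integral _ (b i).2 _ (b j).2
  -- The integral Gram matrix has determinant covolume² = 1, so it is invertible over ℤ and pairing
  -- with the basis hits every integer vector exactly once.
  have hdet : (Matrix.of G).det = 1 := by
    have h := covolume_sq_eq_det_gram b
    rw [hΛ.covolume_eq_one, one_pow] at h
    have h2 : (Matrix.of fun i j => inner ℝ (b i : Euc n) (b j : Euc n)) =
        (Int.castRingHom ℝ).mapMatrix (Matrix.of G) := by
      ext i j
      simp [hG]
    rw [h2, ← RingHom.map_det] at h
    have h3 : ((Matrix.of G).det : ℝ) = ((1 : ℤ) : ℝ) := by simpa using h.symm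
    exact_mod_cast h3
  have hu : IsUnit (Matrix.of G).transpose.det := by
    rw [Matrix.det_transpose, hdet]
    exact isUnit_one
  refine ⟨b.equivFun.toEquiv.trans
    (Matrix.toLinearEquiv (Pi.basisFun ℤ (Fin n)) (Matrix.of G).transpose hu).toEquiv,
    fun w i => ?_⟩
  rw [coe_eq_sum_repr_smul b w, sum_inner]
  simp [Matrix.toLinearEquiv_apply, Matrix.toLin_eq_toLin', Matrix.toLin'_apply, Matrix.mulVec,
    dotProduct, inner_smul_left, hG, mul_comm]

/-- A full lattice with integral inner products which contains every vector that pairs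
integrally with it is unimodular. -/
lemma isUnimodular_of_selfDual (hd : DiscreteTopology Λ) (hf : IsZLattice ℝ Λ)
    (hint : ∀ x ∈ Λ, ∀ y ∈ Λ, ∃ k : ℤ, inner ℝ x y = (k : ℝ))
    (hdual : ∀ x : Euc n, (∀ y ∈ Λ, ∃ k : ℤ, inner ℝ x y = (k : ℝ)) → x ∈ Λ) :
    IsUnimodular Λ := by
  refine ⟨hd, hf, hint, ?_⟩
  obtain ⟨b⟩ := exists_basis Λ
  choose G hG using fun i j => hint _ (b i).2 _ (b j).2
  set B := b.ofZLatticeBasis ℝ Λ with hB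
  have hBb : ∀ i, B i = (b i : Euc n) := fun i => b.ofZLatticeBasis_apply ℝ Λ i
  -- `D` is the dual basis. It pairs integrally with Λ, so it lies in Λ, and its integer coordinates
  -- form an inverse of the Gram matrix; the determinant is thus ±1, and it equals a positive
  -- square.
  set D : Fin n → Euc n := fun i =>
    (InnerProductSpace.toDual ℝ (Euc n)).symm (LinearMap.toContinuousLinearMap (B.coord i)) with hD
  have hDB : ∀ i x, inner ℝ (D i) x = B.repr x i := by
    intro i x
    simp [hD, InnerProductSpace.toDual_symm_apply]
  have hrepr : ∀ (y : Λ) i, B.repr y i = (b.repr y i : ℝ) := fun y i =>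
    b.ofZLatticeBasis_repr_apply ℝ Λ y i
  have hmem : ∀ i, D i ∈ Λ := fun i => hdual _ fun y hy => ⟨b.repr ⟨y, hy⟩ i, by
    rw [hDB]; exact hrepr ⟨y, hy⟩ i⟩
  have hmul : (Matrix.of fun i j => b.repr ⟨D i, hmem i⟩ j) * Matrix.of G = 1 := by
    ext i j
    have h1 : inner ℝ (D i) (b j : Euc n) = if i = j then 1 else 0 := by
      rw [hDB, ← hBb, B.repr_self, Finsupp.single_apply]
      simp [eq_comm]
    have h2 := coe_eq_sum_repr_smul b ⟨D i, hmem i⟩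
    simp only at h2
    rw [h2, sum_inner] at h1
    simp only [inner_smul_left, hG, conj_trivial] at h1
    rw [Matrix.mul_apply, Matrix.one_apply]
    simp only [Matrix.of_apply]
    have h3 : ((∑ k, b.repr ⟨D i, hmem i⟩ k * G k j : ℤ) : ℝ) =
        ((if i = j then 1 else 0 : ℤ) : ℝ) := by
      push_cast
      exact h1
    exact_mod_cast h3
  have hunit : IsUnit (Matrix.of G).det := by
    have := congrArg Matrix.det hmul
    rw [Matrix.det_mul, Matrix.det_one, mul_comm] at this
    exact IsUnit.of_mul_eq_one _ this
  have hsq := covolume_sq_eq_det_gram b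
  have h2 : (Matrix.of fun i j => inner ℝ (b i : Euc n) (b j : Euc n)) =
      (Int.castRingHom ℝ).mapMatrix (Matrix.of G) := by
    ext i j
    simp [hG]
  rw [h2, ← RingHom.map_det] at hsq
  have hpos := ZLattice.covolume_pos Λ
  rcases Int.isUnit_iff.1 hunit with h | h
  · rw [h] at hsq
    simp only [map_one] at hsq
    nlinarith
  · rw [h] at hsq
    simp only [map_neg, map_one] at hsq
    nlinarith [sq_nonneg (ZLattice.covolume Λ)]

/-- Covolume one says that the parallelepiped of the basis has volume 1, so the Haar measure
normalised by it is Lebesgue measure. -/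
lemma measurePreserving_equivFun_symm [DiscreteTopology Λ] [IsZLattice ℝ Λ]
    (hcov : ZLattice.covolume Λ = 1) (b : Module.Basis (Fin n) ℤ Λ) :
    MeasurePreserving (b.ofZLatticeBasis ℝ Λ).equivFunL.symm volume volume := by
  set B := b.ofZLatticeBasis ℝ Λ with hB
  refine ⟨B.equivFunL.symm.continuous.measurable, ?_⟩
  have h1 : (volume : Measure (Fin n → ℝ)) = (Pi.basisFun ℝ (Fin n)).addHaar := by
    rw [Module.Basis.addHaar, Module.Basis.parallelepiped_basisFun, addHaarMeasure_eq_volume_pi]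
  rw [h1, Module.Basis.map_addHaar]
  have h2 : (Pi.basisFun ℝ (Fin n)).map B.equivFunL.symm.toLinearEquiv = B := by
    ext1 i
    change B.equivFun.symm (Pi.basisFun ℝ (Fin n) i) = B i
    simp [Module.Basis.equivFun_symm_apply, Pi.single_apply]
  rw [h2, Module.Basis.addHaar_eq_iff, Module.Basis.coe_parallelepiped,
    ← measure_congr (ZSpan.fundamentalDomain_ae_parallelepiped B volume)]
  rw [ZLattice.covolume_eq_measure_fundamentalDomain Λ volume
      (ZLattice.isAddFundamentalDomain b volume),
    measureReal_def] at hcov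
  rw [← ENNReal.ofReal_toReal (a := volume (ZSpan.fundamentalDomain B)), hcov]
  · simp
  · exact (ZSpan.fundamentalDomain_isBounded B).measure_lt_top.ne

end Gram

/-! ### Poisson summation for Gaussians over a unimodular lattice -/

section LatticePoisson

open MeasureTheory

variable {n : ℕ} {Λ : Submodule ℤ (Euc n)}

lemma norm_cexp_neg_mul_norm_sq (c : ℂ) (v : Euc n) :
    ‖Complex.exp (-(π * c) * ‖v‖ ^ 2)‖ = rexp (-(π * c.re) * ‖v‖ ^ 2) := by
  rw [Complex.norm_exp]
  congr 1
  rw [← Complex.ofReal_pow, ← neg_mul, mul_assoc, ← Complex.ofReal_neg, Complex.re_ofReal_mul,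
    Complex.re_mul_ofReal]
  ring

/-- Poisson summation for Gaussians over a unimodular lattice. -/
theorem IsUnimodular.poisson (hΛ : IsUnimodular Λ) {c : ℂ} (hc : 0 < c.re) (x : Euc n) :
    ∑' v : Λ, Complex.exp (-(π * c) * ‖(v : Euc n) + x‖ ^ 2) =
      (1 / c) ^ (n / 2 : ℂ) * ∑' w : Λ, Complex.exp (-(π / c) * ‖(w : Euc n)‖ ^ 2) *
        Complex.exp (2 * π * Complex.I * (inner ℝ (w : Euc n) x : ℝ)) := by
  have := hΛ.discrete
  have := hΛ.full
  obtain ⟨b⟩ := exists_basis Λ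
  obtain ⟨φ, hφ⟩ := hΛ.exists_dual_equiv b
  set B := b.ofZLatticeBasis ℝ Λ with hB
  have hBb : ∀ i, B i = (b i : Euc n) := fun i => b.ofZLatticeBasis_apply ℝ Λ i
  set E := B.equivFunL.symm with hE
  have hEx : ∀ x : Fin n → ℝ, E x = ∑ i, x i • (b i : Euc n) := by
    intro x
    change B.equivFun.symm x = _
    simp [Module.Basis.equivFun_symm_apply, hBb]
  have hEint : ∀ v : Λ, E (fun i => ((b.equivFun v i : ℤ) : ℝ)) = v := by
    intro v
    rw [hEx, coe_eq_sum_repr_smul b v]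
    rfl
  have hpres : MeasurePreserving E volume volume :=
    measurePreserving_equivFun_symm hΛ.covolume_eq_one b
  have hemb : MeasurableEmbedding E := E.toHomeomorph.measurableEmbedding
  have hbre : 0 < (π * c : ℂ).re := by rw [Complex.re_ofReal_mul]; positivity
  have hc0 : c ≠ 0 := by rintro rfl; simp at hc
  have hcinv : 0 < (1 / c).re := by
    rw [one_div, Complex.inv_re]
    exact div_pos hc (Complex.normSq_pos.2 hc0)
  set γ : Euc n → ℂ := fun v => Complex.exp (-(π * c) * ‖v‖ ^ 2) with hγ
  have hγint : Integrable γ := by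
    simpa [hγ] using GaussianFourier.integrable_cexp_neg_mul_sq_norm_add hbre 0 (0 : Euc n)
  set g : (Fin n → ℝ) → ℂ := fun y => γ (E y) with hg
  have hγc : Continuous γ := by
    rw [hγ]
    exact Complex.continuous_exp.comp
      (continuous_const.mul ((Complex.continuous_ofReal.comp continuous_norm).pow 2))
  have hgc : Continuous g := hγc.comp E.continuous
  have hgint : Integrable g := (hpres.integrable_comp_emb hemb).2 hγint
  have hadd : ∀ (y : Fin n → ℝ) (m : Fin n → ℤ),
      E (y + fun i => (m i : ℝ)) = ((b.equivFun.symm m : Λ) : Euc n) + E y := by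
    intro y m
    rw [map_add, add_comm, ← hEint (b.equivFun.symm m), LinearEquiv.apply_symm_apply]
  -- From ‖v‖² ≤ 2‖v + Ey‖² + 2M², a Gaussian in v with half the rate dominates uniformly on bounded
  -- sets.
  have hloc : ∀ R : ℝ, ∃ u : (Fin n → ℤ) → ℝ, Summable u ∧
      ∀ m y, ‖y‖ ≤ R → ‖g (y + fun i => (m i : ℝ))‖ ≤ u m := by
    intro R
    set M := ‖(E : (Fin n → ℝ) →L[ℝ] Euc n)‖ * R
    have hs := (summable_exp_neg_mul_norm_add_sq Λ 0
      (show 0 < π * c.re / 2 by positivity)).mul_left (rexp (π * c.re * M ^ 2))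
    refine ⟨_, (b.equivFun.symm.toEquiv.summable_iff).2 hs, fun m y hy => ?_⟩
    simp only [hg, hγ, norm_cexp_neg_mul_norm_sq, hadd, Function.comp_apply, add_zero]
    rw [← Real.exp_add]
    refine Real.exp_le_exp.2 ?_
    set v : Euc n := ((b.equivFun.symm m : Λ) : Euc n)
    change -(π * c.re) * ‖v + E y‖ ^ 2 ≤ π * c.re * M ^ 2 + -(π * c.re / 2) * ‖v‖ ^ 2
    have h1 : ‖E y‖ ≤ M := ((E : (Fin n → ℝ) →L[ℝ] Euc n).le_opNorm y).trans
      (mul_le_mul_of_nonneg_left hy (norm_nonneg _))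
    have h2 : ‖v‖ ≤ ‖v + E y‖ + ‖E y‖ := by
      simpa using norm_sub_le (v + E y) (E y)
    have h3 : ‖v‖ ^ 2 ≤ 2 * ‖v + E y‖ ^ 2 + 2 * M ^ 2 := by
      have := norm_nonneg v
      have := norm_nonneg (E y)
      nlinarith [sq_nonneg (‖v + E y‖ - ‖E y‖)]
    have h4 : 0 < π * c.re := by positivity
    nlinarith
  have hinner : ∀ (w : Λ) (y : Fin n → ℝ),
      ∑ i, ((φ w i : ℤ) : ℝ) * y i = inner ℝ (w : Euc n) (E y) := by
    intro w y
    rw [hEx, inner_sum]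
    refine Finset.sum_congr rfl fun i _ => ?_
    rw [inner_smul_right, hφ, mul_comm]
  -- By unimodularity φ labels the frequencies by lattice vectors w, so the Fourier coefficient is
  -- the transform of the Gaussian at w.
  have hcoef : ∀ w : Λ, ∫ y, eChar (-(φ w)) y * g y =
      (1 / c) ^ (n / 2 : ℂ) * Complex.exp (-(π / c) * ‖(w : Euc n)‖ ^ 2) := by
    intro w
    let ψ : Euc n → ℂ := fun v =>
      Complex.exp (((-2 * π * inner ℝ v (w : Euc n) : ℝ) : ℂ) * Complex.I) • γ v
    have h1 : ∀ y, eChar (-(φ w)) y * g y = ψ (E y) := by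
      intro y
      simp only [ψ, eChar, Pi.neg_apply, Int.cast_neg, neg_mul, Finset.sum_neg_distrib, hinner,
        smul_eq_mul, hg]
      rw [real_inner_comm]
      congr 2
      push_cast
      ring
    refine (integral_congr_ae (Eventually.of_forall h1)).trans
      ((hpres.integral_comp hemb ψ).trans ?_)
    rw [← Real.fourier_eq', fourier_gaussian_innerProductSpace hbre]
    have hpi : (π : ℂ) ≠ 0 := by exact_mod_cast pi_ne_zero
    congr 2
    · field_simp
    · simp
    · field_simp
  have hgsum : ∀ c' : ℂ, 0 < c'.re →
      Summable fun w : Λ => Complex.exp (-(π * c') * ‖(w : Euc n)‖ ^ 2) := by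
    intro c' hc'
    refine Summable.of_norm ?_
    simp_rw [norm_cexp_neg_mul_norm_sq]
    simpa using summable_exp_neg_mul_norm_add_sq Λ 0 (show 0 < π * c'.re by positivity)
  have hsum : Summable fun k : Fin n → ℤ => ∫ y, eChar (-k) y * g y := by
    rw [← φ.summable_iff]
    refine ((hgsum _ hcinv).mul_left ((1 / c) ^ (n / 2 : ℂ))).congr fun w => ?_
    rw [Function.comp_apply, hcoef, mul_one_div]
  have key := tsum_translates_eq_tsum_fourier hgc hgint hloc hsum (E.symm x)
  rw [← b.equivFun.toEquiv.tsum_eq, ← φ.tsum_eq] at key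
  have hl : ∀ v : Λ, g (E.symm x + fun i => ((b.equivFun.toEquiv v i : ℤ) : ℝ)) =
      Complex.exp (-(π * c) * ‖(v : Euc n) + x‖ ^ 2) := by
    intro v
    simp only [hg, hγ]
    rw [hadd]
    simp
  simp_rw [hl] at key
  rw [key, ← tsum_mul_left]
  refine tsum_congr fun w => ?_
  rw [hcoef, mul_assoc]
  congr 3
  rw [eChar, hinner]
  simp

end LatticePoisson

lemma slash_T_apply (f : ℍ → ℂ) (k : ℤ) (τ : ℍ) :
    (f ∣[k] ModularGroup.T) τ = f ((1 : ℝ) +ᵥ τ) := by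
  rw [ModularForm.SL_slash_apply, modular_T_smul]
  simp [ModularGroup.denom_apply, ModularGroup.coe_T]

lemma coe_one_vadd (τ : ℍ) : (((1 : ℝ) +ᵥ τ : ℍ) : ℂ) = τ + 1 := by
  rw [coe_vadd, add_comm]
  simp

/-- A holomorphic function, bounded at infinity and invariant under `S` and `T`, as a modular
form of level one. -/
def levelOneForm (f : ℍ → ℂ) (k : ℤ) (hS : f ∣[k] ModularGroup.S = f)
    (hT : f ∣[k] ModularGroup.T = f) (hol : MDiff f) (hb : IsBoundedAtImInfty f) :
    ModularForm 𝒮ℒ k where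
  toFun := f
  slash_action_eq' := fun _ ⟨γ, hγ⟩ =>
    hγ ▸ SlashInvariantForm.slash_action_generators_SL2Z hS hT γ
  holo' := hol
  bdd_at_cusps' {c} hc := by
    rw [Subgroup.IsArithmetic.isCusp_iff_isCusp_SL2Z] at hc
    rw [OnePoint.isBoundedAt_iff_forall_SL2Z hc]
    intro γ _
    rwa [SlashInvariantForm.slash_action_generators_SL2Z hS hT]

/-! ### Tails of q-series -/

section QSeries

lemma norm_qParam_eq {h : ℝ} (τ : ℍ) :
    ‖Function.Periodic.qParam h τ‖ = rexp (-2 * π * τ.im / h) := by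
  rw [Function.Periodic.norm_qParam]
  rfl

/-- The tail of a `q`-series is bounded by the corresponding power of `q`. -/
lemma sub_sum_qSeries_isBigO {f : ℍ → ℂ} {c : ℕ → ℂ} {h : ℝ} (hh : 0 < h)
    (hf : ∀ τ : ℍ, HasSum (fun m => c m • Function.Periodic.qParam h τ ^ m) (f τ)) (N : ℕ) :
    (fun τ : ℍ => f τ - ∑ m ∈ Finset.range N, c m * Function.Periodic.qParam h τ ^ m)
      =O[atImInfty] fun τ : ℍ => rexp (-2 * π * N / h * τ.im) := by
  set g : ℍ → ℂ := fun τ => (f τ - ∑ m ∈ Finset.range N, c m * Function.Periodic.qParam h τ ^ m) /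
    Function.Periodic.qParam h τ ^ N with hg
  have hgsum : ∀ τ : ℍ,
      HasSum (fun m => c (m + N) • Function.Periodic.qParam h τ ^ m) (g τ) := by
    intro τ
    have hq : Function.Periodic.qParam h (τ : ℂ) ≠ 0 := Function.Periodic.qParam_ne_zero _
    have h1 := ((hasSum_nat_add_iff' N).2 (hf τ)).div_const (Function.Periodic.qParam h τ ^ N)
    refine h1.congr_fun fun m => ?_
    simp only [smul_eq_mul]
    rw [pow_add]
    field_simp
  have hb := isBoundedAtImInfty_of_hasSum_qExpansion hh hgsum
  have h2 := (show g =O[atImInfty] (1 : ℍ → ℝ) from hb).mul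
    (isBigO_refl (fun τ : ℍ => Function.Periodic.qParam h τ ^ N) atImInfty).norm_right
  have h3 : (fun τ : ℍ => f τ - ∑ m ∈ Finset.range N, c m * Function.Periodic.qParam h τ ^ m) =
      fun τ => g τ * Function.Periodic.qParam h τ ^ N := by
    ext τ
    have hq : Function.Periodic.qParam h (τ : ℂ) ≠ 0 := Function.Periodic.qParam_ne_zero _
    simp only [hg]
    field_simp
  rw [h3]
  refine h2.trans (.of_bound 1 (Eventually.of_forall fun τ => ?_))
  simp only [Pi.one_apply, one_mul, norm_pow, norm_qParam_eq,
    Real.norm_of_nonneg (Real.exp_pos _).le]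
  rw [← Real.exp_nat_mul]
  apply le_of_eq
  congr 1
  ring

end QSeries

/-! ### Modular behaviour of lattice theta functions -/

section Theta

variable {n : ℕ} {Λ : Submodule ℤ (Euc n)}

/-- The theta function of a lattice on the upper half plane. -/
def thetaFn (Λ : Submodule ℤ (Euc n)) (τ : ℍ) : ℂ := theta Λ τ

lemma thetaFn_eq_expSum (Λ : Submodule ℤ (Euc n)) :
    thetaFn Λ = expSum (fun _ => 1) fun v : Λ => ‖(v : Euc n)‖ ^ 2 := by
  ext τ
  simp [thetaFn, theta, expSum]

lemma summable_exp_norm_add_sq (Λ : Submodule ℤ (Euc n)) [DiscreteTopology Λ] (x : Euc n) (y : ℝ)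
    (hy : 0 < y) : Summable fun v : Λ => rexp (-π * ‖(v : Euc n) + x‖ ^ 2 * y) := by
  refine (summable_exp_neg_mul_norm_add_sq Λ x (show 0 < π * y by positivity)).congr fun v => ?_
  congr 1
  ring

lemma summable_exp_norm_sq (Λ : Submodule ℤ (Euc n)) [DiscreteTopology Λ] (y : ℝ)
    (hy : 0 < y) : Summable fun v : Λ => rexp (-π * ‖(v : Euc n)‖ ^ 2 * y) := by
  simpa using summable_exp_norm_add_sq Λ 0 y hy

lemma mdifferentiable_thetaFn (Λ : Submodule ℤ (Euc n)) [DiscreteTopology Λ] :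
    MDiff (thetaFn Λ) := by
  rw [thetaFn_eq_expSum]
  exact mdifferentiable_expSum (by simp) (fun v => by positivity) (summable_exp_norm_sq Λ)

/-- This is Poisson summation at c = -iτ; the factor (i/τ)²⁰ is τ⁻²⁰ because 4 divides 20, so no
sign appears in rank 40. -/
lemma IsUnimodular.expSum_translate {Λ : Submodule ℤ (Euc 40)} (hΛ : IsUnimodular Λ) (x : Euc 40)
    (τ : ℍ) :
    expSum (fun _ => 1) (fun v : Λ => ‖(v : Euc 40) + x‖ ^ 2) τ =
      expSum (fun w : Λ => Complex.exp (2 * π * Complex.I * (inner ℝ (w : Euc 40) x : ℝ)))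
        (fun w : Λ => ‖(w : Euc 40)‖ ^ 2) ⟨(-τ)⁻¹, τ.im_inv_neg_coe_pos⟩ * (τ : ℂ) ^ (-20 : ℤ) := by
  have hc : 0 < (-Complex.I * (τ : ℂ)).re := by simpa using τ.im_pos
  have hτ : (τ : ℂ) ≠ 0 := τ.ne_zero
  have h := hΛ.poisson hc x
  have h1 : (1 / (-Complex.I * (τ : ℂ))) ^ ((40 : ℕ) / 2 : ℂ) = (τ : ℂ) ^ (-20 : ℤ) := by
    rw [show ((40 : ℕ) / 2 : ℂ) = (20 : ℕ) by norm_num, Complex.cpow_natCast, one_div, mul_inv,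
      mul_pow, zpow_neg, ← inv_zpow]
    have : (-Complex.I)⁻¹ ^ 20 = (1 : ℂ) := by
      rw [inv_neg, Complex.inv_I, neg_neg, show 20 = 4 * 5 from rfl, pow_mul, Complex.I_pow_four,
        one_pow]
    rw [this, one_mul]
    norm_cast
  rw [h1] at h
  unfold expSum
  refine Eq.trans (tsum_congr fun v => ?_) (h.trans ?_)
  · rw [one_mul]
    congr 1
    push_cast
    ring
  · refine (mul_comm _ _).trans (congrArg (· * _) (tsum_congr fun w => ?_))
    rw [mul_comm]
    congr 2
    push_cast
    field_simp
    rw [Complex.I_sq]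
    ring

lemma IsUnimodular.thetaFn_slash_S {Λ : Submodule ℤ (Euc 40)} (hΛ : IsUnimodular Λ) :
    thetaFn Λ ∣[(20 : ℤ)] ModularGroup.S = thetaFn Λ := by
  ext τ
  rw [SlashInvariantForm.slash_S_apply, thetaFn_eq_expSum]
  simpa using (hΛ.expSum_translate 0 τ).symm

/-- For a lattice with integral inner products, half the parity of the norm is given by pairing
with some vector. -/
lemma IsUnimodular.exists_characteristic (hΛ : IsUnimodular Λ) :
    ∃ x : Euc n, ∀ v ∈ Λ, ∃ k : ℤ, ‖v‖ ^ 2 = 2 * inner ℝ v x + 2 * (k : ℝ) := by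
  have := hΛ.discrete
  have := hΛ.full
  obtain ⟨b⟩ := exists_basis Λ
  set B := b.ofZLatticeBasis ℝ Λ with hB
  have hBb : ∀ i, B i = (b i : Euc n) := fun i => b.ofZLatticeBasis_apply ℝ Λ i
  -- Modulo 2 the norm is additive on Λ, since the cross term is 2⟨v, w⟩. A linear functional with
  -- the right values on a basis therefore represents it everywhere.
  set x : Euc n := (InnerProductSpace.toDual ℝ (Euc n)).symm
    (LinearMap.toContinuousLinearMap (B.constr ℝ fun i => ‖(b i : Euc n)‖ ^ 2 / 2)) with hx
  have hxb : ∀ i, inner ℝ (b i : Euc n) x = ‖(b i : Euc n)‖ ^ 2 / 2 := by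
    intro i
    rw [real_inner_comm, hx, InnerProductSpace.toDual_symm_apply]
    change B.constr ℝ (fun i => ‖(b i : Euc n)‖ ^ 2 / 2) (b i : Euc n) = _
    rw [← hBb, Module.Basis.constr_basis, hBb]
  refine ⟨x, fun v hv => ?_⟩
  have hspan : v ∈ Submodule.span ℤ (Set.range fun i => (b i : Euc n)) := by
    have := coe_eq_sum_repr_smul b ⟨v, hv⟩
    simp only at this
    rw [this]
    refine Submodule.sum_mem _ fun i _ => ?_
    rw [Int.cast_smul_eq_zsmul]
    exact Submodule.smul_mem _ _ (Submodule.subset_span ⟨i, rfl⟩)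
  have hle : Submodule.span ℤ (Set.range fun i => (b i : Euc n)) ≤ Λ :=
    Submodule.span_le.2 (by rintro _ ⟨i, rfl⟩; exact (b i).2)
  clear hv
  induction hspan using Submodule.span_induction with
  | mem v hv =>
    obtain ⟨i, rfl⟩ := hv
    exact ⟨0, by simp [hxb]; ring⟩
  | zero => exact ⟨0, by simp⟩
  | add v w hv hw ihv ihw =>
    obtain ⟨k, hk⟩ := ihv
    obtain ⟨l, hl⟩ := ihw
    obtain ⟨m, hm⟩ := hΛ.integral v (hle hv) w (hle hw)
    refine ⟨k + l + m, ?_⟩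
    rw [norm_add_sq_real, hm, hk, hl, inner_add_left]
    push_cast
    ring
  | smul a v hv ih =>
    obtain ⟨k, hk⟩ := ih
    obtain ⟨m, hm⟩ := hΛ.integral v (hle hv) v (hle hv)
    rw [real_inner_self_eq_norm_sq] at hm
    -- For a multiple a • v, additivity modulo 2 rests on a² ≡ a.
    obtain ⟨r, hr⟩ : ∃ r, a ^ 2 - a = 2 * r := by
      obtain ⟨r, hr⟩ := Int.even_mul_succ_self (a - 1)
      exact ⟨r, by linear_combination hr⟩
    have hr' : (a : ℝ) ^ 2 - a = 2 * r := by exact_mod_cast hr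
    refine ⟨a * k + r * m, ?_⟩
    rw [← Int.cast_smul_eq_zsmul ℝ, norm_smul, mul_pow, inner_smul_left, Real.norm_eq_abs, sq_abs]
    push_cast
    simp only [conj_trivial]
    linear_combination (a : ℝ) * hk + hr' * ‖v‖ ^ 2 + 2 * (r : ℝ) * hm

lemma cexp_pi_I_int_two_mul (k : ℤ) : Complex.exp (π * Complex.I * (2 * (k : ℝ) : ℝ)) = 1 := by
  rw [← Complex.exp_int_mul_two_pi_mul_I k]
  congr 1
  push_cast
  ring

lemma thetaFn_one_vadd (Λ : Submodule ℤ (Euc n)) (τ : ℍ) :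
    thetaFn Λ ((1 : ℝ) +ᵥ τ) = expSum
      (fun v : Λ => Complex.exp (π * Complex.I * (‖(v : Euc n)‖ ^ 2 : ℝ)))
      (fun v : Λ => ‖(v : Euc n)‖ ^ 2) τ := by
  rw [thetaFn_eq_expSum]
  refine tsum_congr fun v => ?_
  rw [coe_one_vadd, mul_add, mul_one, one_mul, Complex.exp_add, mul_comm]

lemma IsEven.thetaFn_slash_T (hΛ : IsEven Λ) (k : ℤ) :
    thetaFn Λ ∣[k] ModularGroup.T = thetaFn Λ := by
  ext τ
  rw [slash_T_apply, thetaFn_one_vadd, thetaFn_eq_expSum]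
  congr 1
  ext v
  obtain ⟨k, hk⟩ := hΛ v v.2
  rw [hk, cexp_pi_I_int_two_mul]

lemma IsUnimodular.norm_sq_int (hΛ : IsUnimodular Λ) {v : Euc n} (hv : v ∈ Λ) :
    ∃ k : ℤ, ‖v‖ ^ 2 = (k : ℝ) := by
  obtain ⟨k, hk⟩ := hΛ.integral v hv v hv
  exact ⟨k, by rw [← hk, real_inner_self_eq_norm_sq]⟩

lemma IsUnimodular.norm_sq_nat (hΛ : IsUnimodular Λ) {v : Euc n} (hv : v ∈ Λ) :
    ∃ k : ℕ, ‖v‖ ^ 2 = (k : ℝ) := by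
  obtain ⟨k, hk⟩ := hΛ.norm_sq_int hv
  have h0 : (0 : ℝ) ≤ k := by rw [← hk]; positivity
  have h0' : 0 ≤ k := by exact_mod_cast h0
  lift k to ℕ using h0'
  exact ⟨k, by simpa using hk⟩

lemma IsUnimodular.thetaFn_slash_T_T (hΛ : IsUnimodular Λ) (k : ℤ) :
    (thetaFn Λ ∣[k] ModularGroup.T) ∣[k] ModularGroup.T = thetaFn Λ := by
  ext τ
  rw [slash_T_apply, slash_T_apply, thetaFn_one_vadd, thetaFn_eq_expSum]
  refine tsum_congr fun v => ?_
  obtain ⟨k, hk⟩ := hΛ.norm_sq_int v.2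
  have h1 := cexp_pi_I_int_two_mul k
  rw [← hk] at h1
  rw [coe_one_vadd, mul_add, mul_one, one_mul, Complex.exp_add, ← mul_assoc, mul_comm, ← mul_assoc,
    ← Complex.exp_add]
  have : (π * Complex.I * (‖(v : Euc n)‖ ^ 2 : ℝ) + π * Complex.I * (‖(v : Euc n)‖ ^ 2 : ℝ) : ℂ) =
      π * Complex.I * (2 * ‖(v : Euc n)‖ ^ 2 : ℝ) := by push_cast; ring
  rw [this, h1, one_mul]

/-- T twists the theta function by (-1)^‖v‖², which equals the character exp(2πi⟨v, x⟩) of a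
characteristic vector; Poisson summation exchanges this character for translation by x. The
translated sum shows the behaviour at the cusp 1. -/
lemma IsUnimodular.exists_shadow {Λ : Submodule ℤ (Euc 40)} (hΛ : IsUnimodular Λ) :
    ∃ x : Euc 40, (thetaFn Λ ∣[(20 : ℤ)] ModularGroup.T) ∣[(20 : ℤ)] ModularGroup.S =
      expSum (fun _ => 1) fun v : Λ => ‖(v : Euc 40) + x‖ ^ 2 := by
  obtain ⟨x, hx⟩ := hΛ.exists_characteristic
  refine ⟨x, ?_⟩
  ext τ
  rw [SlashInvariantForm.slash_S_apply, slash_T_apply, thetaFn_one_vadd, hΛ.expSum_translate x τ]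
  congr 2
  ext v
  obtain ⟨k, hk⟩ := hx v v.2
  rw [hk]
  have h1 := cexp_pi_I_int_two_mul k
  push_cast at h1 ⊢
  rw [mul_add, Complex.exp_add, h1, mul_one]
  congr 1
  ring

lemma IsUnimodular.isBoundedAtImInfty_shadow {Λ : Submodule ℤ (Euc 40)} (hΛ : IsUnimodular Λ) :
    IsBoundedAtImInfty ((thetaFn Λ ∣[(20 : ℤ)] ModularGroup.T) ∣[(20 : ℤ)] ModularGroup.S) := by
  obtain ⟨x, hx⟩ := hΛ.exists_shadow
  have := hΛ.discrete
  rw [hx]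
  exact expSum_isBigO_one (by simp) (fun v => by positivity) (summable_exp_norm_add_sq Λ x)

lemma finite_norm_sq_eq (Λ : Submodule ℤ (Euc n)) [DiscreteTopology Λ] (r : ℝ) :
    {x : Euc n | x ∈ Λ ∧ ‖x‖ ^ 2 = r}.Finite := by
  have : DiscreteTopology Λ.toAddSubgroup := ‹_›
  have hc : IsClosed (Λ : Set (Euc n)) := Λ.toAddSubgroup.isClosed_of_discrete
  refine (Metric.finite_isBounded_inter_isClosed (K := Metric.closedBall (0 : Euc n) (√r))
    (s := (Λ : Set (Euc n))) ⟨‹_›⟩ Metric.isBounded_closedBall hc).subset ?_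
  rintro x ⟨hx, hr⟩
  refine ⟨?_, hx⟩
  rw [mem_closedBall_zero_iff, ← hr, Real.sqrt_sq (norm_nonneg x)]

/-- The theta function is the sum of the theta series. -/
lemma IsUnimodular.hasSum_thetaFn (hΛ : IsUnimodular Λ) (τ : ℍ) :
    HasSum (fun k : ℕ => (Set.ncard {x : Euc n | x ∈ Λ ∧ ‖x‖ ^ 2 = (k : ℝ)} : ℂ) •
      Function.Periodic.qParam 2 τ ^ k) (thetaFn Λ τ) := by
  have := hΛ.discrete
  choose κ hκ using fun v : Λ => hΛ.norm_sq_nat v.2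
  have hs := summable_expSum_term (a := fun _ : Λ => 1) (by simp) (summable_exp_norm_sq Λ) τ
  have h := hs.hasSum
  rw [← (Equiv.sigmaFiberEquiv κ).hasSum_iff] at h
  rw [thetaFn_eq_expSum]
  refine h.sigma fun k => ?_
  have hset : ∀ v : Λ, κ v = k ↔ ‖(v : Euc n)‖ ^ 2 = k := by
    intro v
    rw [hκ]
    exact Nat.cast_inj.symm
  let e : {v : Λ // κ v = k} ≃ {x : Euc n | x ∈ Λ ∧ ‖x‖ ^ 2 = (k : ℝ)} :=
    { toFun := fun v => ⟨v.1, v.1.2, (hset _).1 v.2⟩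
      invFun := fun x => ⟨⟨x.1, x.2.1⟩, (hset _).2 x.2.2⟩
      left_inv := fun _ => rfl
      right_inv := fun _ => rfl }
  have hfin : Finite {v : Λ // κ v = k} := by
    have := (finite_norm_sq_eq Λ (k : ℝ)).to_subtype
    exact Finite.of_equiv _ e.symm
  have := Fintype.ofFinite {v : Λ // κ v = k}
  have hterm : ∀ v : {v : Λ // κ v = k},
      ((fun i : Λ => (1 : ℂ) * Complex.exp (π * Complex.I * (‖(i : Euc n)‖ ^ 2 : ℝ) * τ)) ∘
        (Equiv.sigmaFiberEquiv κ)) ⟨k, v⟩ = Function.Periodic.qParam 2 τ ^ k := by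
    intro v
    simp only [Function.comp_apply, Equiv.sigmaFiberEquiv_apply, one_mul]
    rw [(hset _).1 v.2, Function.Periodic.qParam, ← Complex.exp_nat_mul]
    congr 1
    push_cast
    ring
  simp_rw [hterm]
  convert hasSum_fintype
    (fun _ : {v : Λ // κ v = k} => Function.Periodic.qParam 2 (τ : ℂ) ^ k) using 1
  rw [Finset.sum_const, Finset.card_univ, nsmul_eq_mul, smul_eq_mul, ← Nat.card_eq_fintype_card,
    Nat.card_congr e, Nat.card_coe_set_eq]

end Theta

/-! ### Vanishing criteria for level-one forms -/

section LevelOne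

lemma slash_pow_SL2 (f : ℍ → ℂ) (k : ℤ) (γ : SL(2, ℤ)) (m : ℕ) :
    (f ^ m) ∣[(m * k : ℤ)] γ = (f ∣[k] γ) ^ m := by
  induction m with
  | zero =>
    rw [pow_zero, pow_zero, Nat.cast_zero, zero_mul]
    ext τ
    simp [ModularForm.SL_slash_apply]
  | succ m ih =>
    rw [pow_succ, pow_succ, ← ih, ← ModularForm.mul_slash_SL2]
    congr 1
    push_cast
    ring

/-- A form of level one which vanishes at infinity to an order exceeding a twelfth of its weight
is zero. -/
lemma eq_zero_of_isBigO {f : ℍ → ℂ} {k : ℤ} (hS : f ∣[k] ModularGroup.S = f)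
    (hT : f ∣[k] ModularGroup.T = f) (hol : MDiff f) (m : ℕ) (hk : k < m * 12)
    (hO : f =O[atImInfty] fun τ => rexp (-2 * π * m * τ.im)) : f = 0 := by
  set Δ := ModularForm.discriminant
  have hΔ : ∀ τ, Δ τ ≠ 0 := ModularForm.discriminant_ne_zero
  -- Since Δ has no zeros in ℍ, f / Δ^m is a holomorphic form of negative weight k - 12m; the decay
  -- hypothesis keeps it bounded at infinity.
  have hinv : ∀ γ : SL(2, ℤ), f ∣[k] γ = f → Δ ∣[(12 : ℤ)] γ = Δ →
      (f / Δ ^ m) ∣[k - m * 12] γ = f / Δ ^ m := by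
    intro γ h1 h2
    rw [ModularForm.div_slash_SL2, h1, slash_pow_SL2, h2]
  have hb : IsBoundedAtImInfty (f / Δ ^ m) := by
    have h1 : (fun τ : ℍ => rexp (-2 * π * m * τ.im)) =O[atImInfty] (Δ ^ m) := by
      refine (ModularForm.exp_isBigO_discriminant.pow m).congr_left fun τ => ?_
      rw [← Real.exp_nat_mul]
      ring_nf
    exact (div_isBoundedUnder_of_isBigO (hO.trans h1)).isBigO_one ℝ
  have hol' : MDiff (f / Δ ^ m) := by
    have hd : MDiff Δ := CuspForm.discriminant.holo'
    exact hol.div (hd.pow m) fun τ => pow_ne_zero m (hΔ τ)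
  have := ModularFormClass.levelOne_neg_weight_eq_zero (k := k - m * 12) (by linarith)
    (levelOneForm (f / Δ ^ m) (k - m * 12)
      (hinv _ hS ModularForm.discriminant_S_invariant)
      (hinv _ hT ModularForm.discriminant_T_invariant) hol' hb)
  ext τ
  have h1 : f τ / Δ τ ^ m = 0 := congrFun this τ
  rcases div_eq_zero_iff.1 h1 with h | h
  · exact h
  · exact absurd h (pow_ne_zero m (hΔ τ))

/-- Periodicity upgrades mere vanishing at infinity to decay of order exp(-2π Im τ), which is one
full order of vanishing. -/
lemma eq_zero_of_isZeroAtImInfty {f : ℍ → ℂ} {k : ℤ} (hS : f ∣[k] ModularGroup.S = f)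
    (hT : f ∣[k] ModularGroup.T = f) (hol : MDiff f) (hk : k < 12)
    (h0 : IsZeroAtImInfty f) : f = 0 := by
  refine eq_zero_of_isBigO hS hT hol 1 (by simpa using hk) ?_
  have hb : IsBoundedAtImInfty f := h0.isBigO_one ℝ
  have := h0.exp_decay_atImInfty one_pos
    (SlashInvariantFormClass.periodic_comp_ofComplex (levelOneForm f k hS hT hol hb)
      one_mem_strictPeriods_SL) hol hb
  simpa using this

end LevelOne

/-! ### Jacobi theta constants and their transformation laws -/

section Jacobi

/-- The theta constant `θ₃`. -/
def theta3 : ℍ → ℂ := expSum (fun _ : ℤ => 1) fun n => (n : ℝ) ^ 2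

/-- The theta constant `θ₄`. -/
def theta4 : ℍ → ℂ := expSum (fun n : ℤ => Complex.exp (π * Complex.I * n)) fun n => (n : ℝ) ^ 2

/-- The theta constant `θ₂`, divided by `exp(π i τ / 4)`. -/
def theta2Aux : ℍ → ℂ := expSum (fun _ : ℤ => 1) fun n => (n : ℝ) ^ 2 + n

/-- The theta constant `θ₂`. -/
def theta2 (τ : ℍ) : ℂ := Complex.exp (π * Complex.I * τ / 4) * theta2Aux τ

lemma theta3_eq (τ : ℍ) : theta3 τ = jacobiTheta₂ 0 τ := by
  refine tsum_congr fun n => ?_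
  rw [jacobiTheta₂_term, one_mul]
  congr 1
  push_cast
  ring

lemma theta4_eq (τ : ℍ) : theta4 τ = jacobiTheta₂ (1 / 2) τ := by
  refine tsum_congr fun n => ?_
  rw [jacobiTheta₂_term, ← Complex.exp_add]
  congr 1
  push_cast
  ring

lemma theta2Aux_eq (τ : ℍ) : theta2Aux τ = jacobiTheta₂ (τ / 2) τ := by
  refine tsum_congr fun n => ?_
  rw [jacobiTheta₂_term, one_mul]
  congr 1
  push_cast
  ring

lemma summable_exp_int_sq (y : ℝ) (hy : 0 < y) :
    Summable fun n : ℤ => rexp (-π * (n : ℝ) ^ 2 * y) := by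
  have := ((summable_jacobiTheta₂_term_iff 0 (y * Complex.I)).2 (by simpa using hy)).norm
  refine this.congr fun n => ?_
  rw [norm_jacobiTheta₂_term]
  simp

lemma summable_exp_int_sq_add (y : ℝ) (hy : 0 < y) :
    Summable fun n : ℤ => rexp (-π * ((n : ℝ) ^ 2 + n) * y) := by
  have := ((summable_jacobiTheta₂_term_iff (y * Complex.I / 2) (y * Complex.I)).2
    (by simpa using hy)).norm
  refine this.congr fun n => ?_
  rw [norm_jacobiTheta₂_term]
  congr 1
  have : (y * Complex.I / 2).im = y / 2 := by
    rw [show (y * Complex.I / 2 : ℂ) = ((y / 2 : ℝ) : ℂ) * Complex.I by push_cast; ring]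
    simp
  rw [this]
  simp
  ring

lemma int_sq_add_nonneg (n : ℤ) : (0 : ℝ) ≤ (n : ℝ) ^ 2 + n := by
  have : 0 ≤ n ^ 2 + n := by
    rcases le_or_gt 0 n with h | h
    · positivity
    · nlinarith
  exact_mod_cast this

lemma norm_exp_pi_I_int (n : ℤ) : ‖Complex.exp (π * Complex.I * n)‖ = 1 := by
  rw [Complex.norm_exp]
  simp

lemma mdifferentiable_theta3 : MDiff theta3 :=
  mdifferentiable_expSum (by simp) (fun n => by positivity) summable_exp_int_sq

lemma mdifferentiable_theta4 : MDiff theta4 :=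
  mdifferentiable_expSum (fun n => (norm_exp_pi_I_int n).le) (fun n => by positivity)
    summable_exp_int_sq

lemma mdifferentiable_theta2Aux : MDiff theta2Aux :=
  mdifferentiable_expSum (by simp) int_sq_add_nonneg summable_exp_int_sq_add

lemma mdifferentiable_theta2 : MDiff theta2 := by
  refine MDifferentiable.mul ?_ mdifferentiable_theta2Aux
  rw [UpperHalfPlane.mdifferentiable_iff]
  have : DifferentiableOn ℂ (fun z : ℂ => Complex.exp (π * Complex.I * z / 4)) {z | 0 < z.im} := by
    fun_prop
  refine this.congr fun z hz => ?_
  simp [ofComplex_apply_of_im_pos hz]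

/-- The point `-1/τ`. -/
abbrev negInv (τ : ℍ) : ℍ := ⟨(-τ)⁻¹, τ.im_inv_neg_coe_pos⟩

lemma theta3_negInv (τ : ℍ) :
    theta3 τ = 1 / (-Complex.I * τ) ^ (1 / 2 : ℂ) * theta3 (negInv τ) := by
  rw [theta3_eq, theta3_eq, jacobiTheta₂_functional_equation]
  simp [neg_div]

/-- Inversion exchanges θ₄ and θ₂ and fixes θ₃, up to the common factor (-iτ)^(-1/2). -/
lemma theta4_negInv (τ : ℍ) :
    theta4 τ = 1 / (-Complex.I * τ) ^ (1 / 2 : ℂ) * theta2 (negInv τ) := by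
  rw [theta4_eq, theta2, theta2Aux_eq, jacobiTheta₂_functional_equation, mul_assoc]
  congr 2
  · congr 1
    have := τ.ne_zero
    field_simp
    norm_num
  · rw [← jacobiTheta₂_neg_left]
    have := τ.ne_zero
    congr 1 <;> field_simp

lemma theta2_negInv (τ : ℍ) :
    theta2 τ = 1 / (-Complex.I * τ) ^ (1 / 2 : ℂ) * theta4 (negInv τ) := by
  rw [theta4_eq, theta2, theta2Aux_eq, jacobiTheta₂_functional_equation]
  have hτ := τ.ne_zero
  have h1 : Complex.exp (π * Complex.I * τ / 4) *
      Complex.exp (-π * Complex.I * (τ / 2 : ℂ) ^ 2 / τ) = 1 := by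
    rw [← Complex.exp_add, ← Complex.exp_zero]
    congr 1
    field_simp
    ring
  have h2 : jacobiTheta₂ ((τ : ℂ) / 2 / τ) (-1 / τ) = jacobiTheta₂ (1 / 2) (negInv τ) := by
    congr 1 <;> field_simp
  rw [h2]
  linear_combination (1 / (-Complex.I * (τ : ℂ)) ^ (1 / 2 : ℂ) *
    jacobiTheta₂ (1 / 2) (negInv τ)) * h1

/-- Fourth powers remove the square root and leave weight 2 with a sign -1; this is the sign in all
the S-laws for fourth powers. -/
lemma weight_factor_pow_four (τ : ℍ) :
    (1 / (-Complex.I * τ) ^ (1 / 2 : ℂ)) ^ 4 = -(τ : ℂ) ^ (-2 : ℤ) := by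
  have h : ((-Complex.I * (τ : ℂ)) ^ (1 / 2 : ℂ)) ^ 4 = (-Complex.I * τ) ^ 2 := by
    rw [← Complex.cpow_nat_mul]
    norm_num
  rw [div_pow, h, one_pow, mul_pow, neg_sq, Complex.I_sq, zpow_neg, neg_one_mul, one_div, inv_neg]
  rfl

lemma theta3_pow_slash_S : (theta3 ^ 4) ∣[(2 : ℤ)] ModularGroup.S = -theta3 ^ 4 := by
  ext τ
  rw [SlashInvariantForm.slash_S_apply]
  simp only [Pi.pow_apply, Pi.neg_apply]
  rw [theta3_negInv τ, mul_pow, weight_factor_pow_four]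
  ring

lemma theta4_pow_slash_S : (theta4 ^ 4) ∣[(2 : ℤ)] ModularGroup.S = -theta2 ^ 4 := by
  ext τ
  rw [SlashInvariantForm.slash_S_apply]
  simp only [Pi.pow_apply, Pi.neg_apply]
  rw [theta2_negInv τ, mul_pow, weight_factor_pow_four]
  ring

lemma theta2_pow_slash_S : (theta2 ^ 4) ∣[(2 : ℤ)] ModularGroup.S = -theta4 ^ 4 := by
  ext τ
  rw [SlashInvariantForm.slash_S_apply]
  simp only [Pi.pow_apply, Pi.neg_apply]
  rw [theta4_negInv τ, mul_pow, weight_factor_pow_four]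
  ring

lemma cexp_pi_I_even {m : ℤ} (hm : Even m) : Complex.exp (π * Complex.I * m) = 1 := by
  obtain ⟨r, rfl⟩ := hm
  rw [← Complex.exp_int_mul_two_pi_mul_I r]
  congr 1
  push_cast
  ring

lemma cexp_eq_of_even {x y : ℂ} {m : ℤ} (hm : Even m) (h : x = y + π * Complex.I * m) :
    Complex.exp x = Complex.exp y := by
  rw [h, Complex.exp_add, cexp_pi_I_even hm, mul_one]

lemma theta3_one_vadd (τ : ℍ) : theta3 ((1 : ℝ) +ᵥ τ) = theta4 τ := by
  refine tsum_congr fun n => ?_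
  rw [coe_one_vadd, one_mul, ← Complex.exp_add]
  refine cexp_eq_of_even (Int.even_mul_pred_self n) ?_
  push_cast
  ring

lemma theta4_one_vadd (τ : ℍ) : theta4 ((1 : ℝ) +ᵥ τ) = theta3 τ := by
  refine tsum_congr fun n => ?_
  rw [coe_one_vadd, one_mul, ← Complex.exp_add]
  refine cexp_eq_of_even (Int.even_mul_succ_self n) ?_
  push_cast
  ring

lemma theta2Aux_one_vadd (τ : ℍ) : theta2Aux ((1 : ℝ) +ᵥ τ) = theta2Aux τ := by
  refine tsum_congr fun n => ?_
  rw [coe_one_vadd, one_mul, one_mul]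
  refine cexp_eq_of_even (Int.even_mul_succ_self n) ?_
  push_cast
  ring

lemma theta3_pow_slash_T : (theta3 ^ 4) ∣[(2 : ℤ)] ModularGroup.T = theta4 ^ 4 := by
  ext τ
  rw [slash_T_apply, Pi.pow_apply, theta3_one_vadd, Pi.pow_apply]

lemma theta4_pow_slash_T : (theta4 ^ 4) ∣[(2 : ℤ)] ModularGroup.T = theta3 ^ 4 := by
  ext τ
  rw [slash_T_apply, Pi.pow_apply, theta4_one_vadd, Pi.pow_apply]

lemma theta2_pow_slash_T : (theta2 ^ 4) ∣[(2 : ℤ)] ModularGroup.T = -theta2 ^ 4 := by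
  ext τ
  rw [slash_T_apply]
  simp only [Pi.pow_apply, Pi.neg_apply, theta2]
  rw [theta2Aux_one_vadd, mul_pow, mul_pow, ← Complex.exp_nat_mul, ← Complex.exp_nat_mul,
    coe_one_vadd, ← neg_mul]
  congr 1
  rw [← neg_one_mul, ← Complex.exp_pi_mul_I, ← Complex.exp_add]
  congr 1
  push_cast
  ring

lemma tendsto_exp_neg_im {c : ℝ} (hc : 0 < c) :
    Tendsto (fun τ : ℍ => rexp (-c * τ.im)) atImInfty (𝓝 0) := by
  have h : Tendsto (fun τ : ℍ => τ.im) atImInfty atTop := tendsto_comap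
  simp_rw [neg_mul]
  exact Real.tendsto_exp_neg_atTop_nhds_zero.comp (h.const_mul_atTop hc)

lemma theta3_sub_one_isBigO :
    (fun τ => theta3 τ - 1) =O[atImInfty] fun τ => rexp (-π * 1 * τ.im) := by
  simpa [theta3] using expSum_sub_sum_isBigO (a := fun _ : ℤ => 1) (k := fun n : ℤ => (n : ℝ) ^ 2)
    (by simp) summable_exp_int_sq {0} (N := 1) (fun n hn => by
      have : n ≠ 0 := by simpa using hn
      have : 0 < n ^ 2 := by positivity
      have : 1 ≤ n ^ 2 := by omega
      exact_mod_cast this)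

lemma theta4_sub_one_isBigO :
    (fun τ => theta4 τ - 1) =O[atImInfty] fun τ => rexp (-π * 1 * τ.im) := by
  simpa [theta4] using expSum_sub_sum_isBigO
    (a := fun n : ℤ => Complex.exp (π * Complex.I * n)) (k := fun n : ℤ => (n : ℝ) ^ 2)
    (fun n => (norm_exp_pi_I_int n).le) summable_exp_int_sq {0} (N := 1) (fun n hn => by
      have : n ≠ 0 := by simpa using hn
      have : 0 < n ^ 2 := by positivity
      have : 1 ≤ n ^ 2 := by omega
      exact_mod_cast this)

lemma theta2Aux_sub_two_isBigO :
    (fun τ => theta2Aux τ - 2) =O[atImInfty] fun τ => rexp (-π * 1 * τ.im) := by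
  -- The exponent n² + n = n(n + 1) vanishes exactly at 0 and -1, which give the constant term 2.
  have := expSum_sub_sum_isBigO (a := fun _ : ℤ => 1) (k := fun n : ℤ => (n : ℝ) ^ 2 + n)
    (by simp) summable_exp_int_sq_add {0, -1} (N := 1) (fun n hn => by
      simp only [Finset.mem_insert, Finset.mem_singleton, not_or] at hn
      have : 1 ≤ n ^ 2 + n := by
        rcases lt_or_gt_of_ne hn.1 with h | h
        · have : n ≤ -2 := by omega
          nlinarith
        · nlinarith
      exact_mod_cast this)
  refine this.congr_left fun τ => ?_
  rw [Finset.sum_pair (by norm_num)]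
  simp [theta2Aux]
  norm_num

lemma tendsto_of_sub_isBigO {f : ℍ → ℂ} {c : ℂ}
    (h : (fun τ => f τ - c) =O[atImInfty] fun τ => rexp (-π * 1 * τ.im)) :
    Tendsto f atImInfty (𝓝 c) := by
  have h0 := h.trans_tendsto (by simpa using tendsto_exp_neg_im pi_pos)
  simpa using h0.add_const c

lemma tendsto_theta3 : Tendsto theta3 atImInfty (𝓝 1) := tendsto_of_sub_isBigO theta3_sub_one_isBigO
lemma tendsto_theta4 : Tendsto theta4 atImInfty (𝓝 1) := tendsto_of_sub_isBigO theta4_sub_one_isBigO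
lemma tendsto_theta2Aux : Tendsto theta2Aux atImInfty (𝓝 2) :=
  tendsto_of_sub_isBigO theta2Aux_sub_two_isBigO

lemma theta2_pow_four (τ : ℍ) :
    theta2 τ ^ 4 = Function.Periodic.qParam 2 τ * theta2Aux τ ^ 4 := by
  rw [theta2, mul_pow, ← Complex.exp_nat_mul, Function.Periodic.qParam]
  congr 2
  push_cast
  ring

lemma tendsto_theta2_pow : Tendsto (theta2 ^ 4) atImInfty (𝓝 0) := by
  have := (qParam_tendsto_atImInfty (h := 2) two_pos).mul (tendsto_theta2Aux.pow 4)
  rw [zero_mul] at this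
  exact this.congr fun τ => (theta2_pow_four τ).symm

end Jacobi

/-! ### Jacobi's identity; E₄ and Δ through theta constants -/

section Jacobi

lemma mul_slash_of_eq {f g f' g' : ℍ → ℂ} {k l : ℤ} {γ : SL(2, ℤ)} (hf : f ∣[k] γ = f')
    (hg : g ∣[l] γ = g') {j : ℤ} (hj : j = k + l) : (f * g) ∣[j] γ = f' * g' := by
  rw [hj, ModularForm.mul_slash_SL2, hf, hg]

lemma pow_slash_of_eq {f f' : ℍ → ℂ} {k : ℤ} {γ : SL(2, ℤ)} (hf : f ∣[k] γ = f') (m : ℕ) {j : ℤ}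
    (hj : j = m * k) : (f ^ m) ∣[j] γ = f' ^ m := by
  rw [hj, slash_pow_SL2, hf]

lemma add_slash_of_eq {f g f' g' : ℍ → ℂ} {k : ℤ} {γ : SL(2, ℤ)} (hf : f ∣[k] γ = f')
    (hg : g ∣[k] γ = g') : (f + g) ∣[k] γ = f' + g' := by
  rw [SlashAction.add_slash, hf, hg]

lemma sub_slash_of_eq {f g f' g' : ℍ → ℂ} {k : ℤ} {γ : SL(2, ℤ)} (hf : f ∣[k] γ = f')
    (hg : g ∣[k] γ = g') : (f - g) ∣[k] γ = f' - g' := by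
  rw [sub_eq_add_neg, SlashAction.add_slash, SlashAction.neg_slash, hf, hg, sub_eq_add_neg]

lemma mdifferentiable_theta3_pow : MDiff (theta3 ^ 4) := mdifferentiable_theta3.pow 4
lemma mdifferentiable_theta4_pow : MDiff (theta4 ^ 4) := mdifferentiable_theta4.pow 4
lemma mdifferentiable_theta2_pow : MDiff (theta2 ^ 4) := mdifferentiable_theta2.pow 4

lemma tendsto_theta3_pow : Tendsto (theta3 ^ 4) atImInfty (𝓝 1) := by
  have := tendsto_theta3.pow 4
  rwa [one_pow] at this

lemma tendsto_theta4_pow : Tendsto (theta4 ^ 4) atImInfty (𝓝 1) := by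
  have := tendsto_theta4.pow 4
  rwa [one_pow] at this

/-- The Jacobi identity between theta constants. -/
theorem theta3_pow_eq : theta3 ^ 4 = theta4 ^ 4 + theta2 ^ 4 := by
  set D : ℍ → ℂ := theta3 ^ 4 - theta4 ^ 4 - theta2 ^ 4 with hD
  have hS : D ∣[(2 : ℤ)] ModularGroup.S = -D := by
    rw [hD, sub_slash_of_eq (sub_slash_of_eq theta3_pow_slash_S theta4_pow_slash_S)
      theta2_pow_slash_S]
    ring
  have hT : D ∣[(2 : ℤ)] ModularGroup.T = -D := by
    rw [hD, sub_slash_of_eq (sub_slash_of_eq theta3_pow_slash_T theta4_pow_slash_T)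
      theta2_pow_slash_T]
    ring
  -- S and T both change the sign of D, so it is D² that has level one; its weight is 4, below 12.
  have h0 : IsZeroAtImInfty (D ^ 2) := by
    have := ((tendsto_theta3_pow.sub tendsto_theta4_pow).sub tendsto_theta2_pow).pow 2
    simp only [sub_self, ne_eq, OfNat.ofNat_ne_zero, not_false_eq_true, zero_pow] at this
    exact this
  have hDD : D ^ 2 = 0 := by
    refine eq_zero_of_isZeroAtImInfty (k := 4) ?_ ?_ ?_ (by norm_num) h0
    · rw [pow_slash_of_eq hS 2 (by norm_num), neg_sq]
    · rw [pow_slash_of_eq hT 2 (by norm_num), neg_sq]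
    · exact MDifferentiable.pow (((mdifferentiable_theta3_pow.sub mdifferentiable_theta4_pow).sub
        mdifferentiable_theta2_pow)) 2
  have : D = 0 := pow_eq_zero_iff two_ne_zero |>.1 hDD
  rw [← sub_eq_zero, ← this, hD]
  ring

lemma hasSum_qExpansion_levelOne {k : ℤ} (f : ModularForm 𝒮ℒ k) (τ : ℍ) :
    HasSum (fun m : ℕ => (qExpansion 1 f).coeff m • Function.Periodic.qParam 1 τ ^ m) (f τ) := by
  have := hasSum_qExpansion one_pos
    (SlashInvariantFormClass.periodic_comp_ofComplex f one_mem_strictPeriods_SL) f.holo'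
    (ModularFormClass.bdd_at_infty f) τ
  simpa using this

lemma tendsto_E₄ : Tendsto (ModularForm.E₄ : ℍ → ℂ) atImInfty (𝓝 1) := by
  have h := sub_sum_qSeries_isBigO one_pos (hasSum_qExpansion_levelOne ModularForm.E₄) 1
  have h0 := h.trans_tendsto (by simpa using tendsto_exp_neg_im (c := 2 * π) (by positivity))
  simp only [Finset.range_one, Finset.sum_singleton, pow_zero, mul_one,
    EisensteinSeries.E_qExpansion_coeff_zero _ ⟨2, rfl⟩] at h0
  simpa using h0.add_const 1

/-- The Eisenstein series of weight four in terms of theta constants. -/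
theorem E₄_eq_theta :
    (ModularForm.E₄ : ℍ → ℂ) =
      (2⁻¹ : ℂ) • ((theta3 ^ 4) ^ 2 + (theta4 ^ 4) ^ 2 + (theta2 ^ 4) ^ 2) := by
  set G : ℍ → ℂ :=
    (theta3 ^ 4) ^ 2 + (theta4 ^ 4) ^ 2 + (theta2 ^ 4) ^ 2 with hG
  have hE : ∀ γ : SL(2, ℤ), (ModularForm.E₄ : ℍ → ℂ) ∣[(4 : ℤ)] γ = ModularForm.E₄ := fun γ =>
    SlashInvariantFormClass.slash_action_eq ModularForm.E₄ _ ⟨γ, rfl⟩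
  have hS : G ∣[(4 : ℤ)] ModularGroup.S = G := by
    rw [hG, add_slash_of_eq (add_slash_of_eq (pow_slash_of_eq theta3_pow_slash_S 2 (by norm_num))
      (pow_slash_of_eq theta4_pow_slash_S 2 (by norm_num)))
      (pow_slash_of_eq theta2_pow_slash_S 2 (by norm_num))]
    ring
  have hT : G ∣[(4 : ℤ)] ModularGroup.T = G := by
    rw [hG, add_slash_of_eq (add_slash_of_eq (pow_slash_of_eq theta3_pow_slash_T 2 (by norm_num))
      (pow_slash_of_eq theta4_pow_slash_T 2 (by norm_num)))
      (pow_slash_of_eq theta2_pow_slash_T 2 (by norm_num))]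
    ring
  have hol : MDiff G := ((mdifferentiable_theta3_pow.pow 2).add
    (mdifferentiable_theta4_pow.pow 2)).add (mdifferentiable_theta2_pow.pow 2)
  have hlim : Tendsto G atImInfty (𝓝 2) := by
    have := ((tendsto_theta3_pow.pow 2).add (tendsto_theta4_pow.pow 2)).add
      (tendsto_theta2_pow.pow 2)
    norm_num at this
    exact this
  have h0 : IsZeroAtImInfty ((ModularForm.E₄ : ℍ → ℂ) - (2⁻¹ : ℂ) • G) := by
    have := tendsto_E₄.sub (hlim.const_smul (2⁻¹ : ℂ))
    simp only [smul_eq_mul, ne_eq, OfNat.ofNat_ne_zero, not_false_eq_true, inv_mul_cancel₀,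
      sub_self] at this
    exact this
  refine sub_eq_zero.1 (eq_zero_of_isZeroAtImInfty (k := 4) ?_ ?_ ?_ (by norm_num) h0)
  · refine sub_slash_of_eq (hE _) ?_
    rw [ModularForm.SL_smul_slash, hS]
  · refine sub_slash_of_eq (hE _) ?_
    rw [ModularForm.SL_smul_slash, hT]
  · exact ModularForm.E₄.holo'.sub (hol.const_smul _)

/-- The modular discriminant in terms of theta constants. -/
theorem discriminant_eq_theta (τ : ℍ) :
    ModularForm.discriminant τ = (theta3 τ ^ 4 * theta4 τ ^ 4 * theta2 τ ^ 4) ^ 2 / 256 := by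
  set P : ℍ → ℂ := theta3 ^ 4 * theta4 ^ 4 * theta2 ^ 4 with hP
  set Δ := ModularForm.discriminant
  have hΔ : ∀ τ, Δ τ ≠ 0 := ModularForm.discriminant_ne_zero
  have hS : P ∣[(6 : ℤ)] ModularGroup.S = -P := by
    rw [hP, mul_slash_of_eq (mul_slash_of_eq theta3_pow_slash_S theta4_pow_slash_S rfl)
      theta2_pow_slash_S (by norm_num)]
    ring
  have hT : P ∣[(6 : ℤ)] ModularGroup.T = -P := by
    rw [hP, mul_slash_of_eq (mul_slash_of_eq theta3_pow_slash_T theta4_pow_slash_T rfl)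
      theta2_pow_slash_T (by norm_num)]
    ring
  have hinv : ∀ γ : SL(2, ℤ), P ∣[(6 : ℤ)] γ = -P → Δ ∣[(12 : ℤ)] γ = Δ →
      (P ^ 2 / Δ - 256 : ℍ → ℂ) ∣[(0 : ℤ)] γ = P ^ 2 / Δ - 256 := by
    intro γ h1 h2
    refine sub_slash_of_eq ?_ ?_
    · rw [show (0 : ℤ) = 12 - 12 by norm_num, ModularForm.div_slash_SL2, h2,
        pow_slash_of_eq h1 2 (by norm_num), neg_sq]
    · ext τ
      simp [ModularForm.SL_slash_apply]
  have hol : MDiff (P ^ 2 / Δ - 256 : ℍ → ℂ) := by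
    have hd : MDiff Δ := CuspForm.discriminant.holo'
    exact (MDifferentiable.div (((mdifferentiable_theta3_pow.mul mdifferentiable_theta4_pow).mul
      mdifferentiable_theta2_pow).pow 2) hd hΔ).sub mdifferentiable_const
  -- θ₂⁸ and Δ each carry one factor exp(2πiτ). After cancelling it the limit is 2⁸ = 256, as the
  -- remaining factor of θ₂ tends to 2.
  have h0 : IsZeroAtImInfty (P ^ 2 / Δ - 256) := by
    have h1 := ((((tendsto_theta3_pow.mul tendsto_theta4_pow).mul
      (tendsto_theta2Aux.pow 4)).pow 2).div
      ModularForm.tendsto_atImInfty_tprod_one_sub_eta_q_pow one_ne_zero).sub_const 256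
    norm_num at h1
    refine Tendsto.congr (fun τ => ?_) h1
    simp only [Pi.sub_apply, Pi.div_apply, Pi.pow_apply, hP, Pi.mul_apply, Pi.ofNat_apply]
    rw [theta2_pow_four, show Δ τ = _ from ModularForm.discriminant_eq_q_prod τ]
    have hq : Function.Periodic.qParam 1 (τ : ℂ) = Function.Periodic.qParam 2 (τ : ℂ) ^ 2 := by
      rw [Function.Periodic.qParam, Function.Periodic.qParam, ← Complex.exp_nat_mul]
      congr 1
      push_cast
      ring
    rw [hq]
    have hq0 : Function.Periodic.qParam 2 (τ : ℂ) ≠ 0 := Function.Periodic.qParam_ne_zero _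
    rw [show ∀ a b c d : ℂ, (a * b * (c * d)) ^ 2 = c ^ 2 * (a * b * d) ^ 2 by intros; ring,
      mul_div_mul_left _ _ (pow_ne_zero 2 hq0)]
  have := congrFun (eq_zero_of_isZeroAtImInfty (k := 0) (hinv _ hS
    ModularForm.discriminant_S_invariant) (hinv _ hT ModularForm.discriminant_T_invariant) hol
    (by norm_num) h0) τ
  simp only [Pi.sub_apply, Pi.div_apply, Pi.pow_apply, hP, Pi.mul_apply, Pi.ofNat_apply,
    sub_eq_zero, div_eq_iff (hΔ τ)] at this
  rw [this]
  ring

end Jacobi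

/-! ### Counting lattice vectors by norm -/

section Count

variable {n : ℕ} {Λ : Submodule ℤ (Euc n)}

/-- The number of lattice vectors of squared length `k`. -/
def normCount (Λ : Submodule ℤ (Euc n)) (k : ℕ) : ℕ :=
  Set.ncard {x : Euc n | x ∈ Λ ∧ ‖x‖ ^ 2 = (k : ℝ)}

lemma normCount_zero (Λ : Submodule ℤ (Euc n)) : normCount Λ 0 = 1 := by
  rw [normCount, Set.ncard_eq_one]
  refine ⟨0, Set.ext fun x => ?_⟩
  simp only [Nat.cast_zero, ne_eq, OfNat.ofNat_ne_zero, not_false_eq_true, pow_eq_zero_iff,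
    norm_eq_zero, Set.mem_ofPred_eq, Set.mem_singleton_iff, and_iff_right_iff_imp]
  rintro rfl
  exact Λ.zero_mem

lemma normCount_eq_zero_iff [DiscreteTopology Λ] (k : ℕ) :
    normCount Λ k = 0 ↔ ∀ x ∈ Λ, ‖x‖ ^ 2 ≠ (k : ℝ) := by
  rw [normCount, Set.ncard_eq_zero (finite_norm_sq_eq Λ k), Set.eq_empty_iff_forall_notMem]
  simp

lemma minNorm_le {x : Euc n} (hx : x ∈ Λ) (h0 : x ≠ 0) : minNorm Λ ≤ ‖x‖ ^ 2 :=
  csInf_le ⟨0, by rintro r ⟨y, -, -, rfl⟩; positivity⟩ ⟨x, hx, h0, rfl⟩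

lemma kissingNumber_eq {m : ℕ} (hm : 0 < m) (h : minNorm Λ = m) :
    kissingNumber Λ = normCount Λ m := by
  rw [kissingNumber, normCount]
  congr 1
  ext x
  simp only [Set.mem_ofPred_eq, h]
  refine ⟨fun hx => ⟨hx.1, hx.2.2⟩, fun hx => ⟨hx.1, ?_, hx.2⟩⟩
  rintro rfl
  exact hm.ne' (by simpa [eq_comm] using hx.2)

lemma normCount_eq_zero_of_lt_minNorm [DiscreteTopology Λ] {k : ℕ} (hk : 0 < k)
    (h : (k : ℝ) < minNorm Λ) : normCount Λ k = 0 := by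
  refine (normCount_eq_zero_iff k).2 fun x hx hxk => ?_
  have h0 : x ≠ 0 := by
    rintro rfl
    exact hk.ne' (by simpa [eq_comm] using hxk)
  linarith [minNorm_le hx h0]

lemma IsUnimodular.minNorm_eq (hΛ : IsUnimodular Λ) {m : ℕ} (hm : 0 < m)
    (h0 : ∀ k, 0 < k → k < m → normCount Λ k = 0) (h : normCount Λ m ≠ 0) :
    minNorm Λ = m := by
  have := hΛ.discrete
  have hne : ∃ x ∈ Λ, ‖x‖ ^ 2 = (m : ℝ) := by
    by_contra hcon
    push Not at hcon
    exact h ((normCount_eq_zero_iff m).2 hcon)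
  obtain ⟨x, hx, hxm⟩ := hne
  have hx0 : x ≠ 0 := by
    rintro rfl
    exact hm.ne' (by simpa [eq_comm] using hxm)
  refine le_antisymm (hxm ▸ minNorm_le hx hx0) (le_csInf ⟨_, x, hx, hx0, rfl⟩ ?_)
  rintro r ⟨y, hy, hy0, rfl⟩
  obtain ⟨k, hk⟩ := hΛ.norm_sq_nat hy
  rw [hk, Nat.cast_le]
  by_contra! hkm
  refine (normCount_eq_zero_iff k).1 (h0 k ?_ hkm) y hy hk
  rw [Nat.pos_iff_ne_zero]
  rintro rfl
  simp at hk
  exact hy0 hk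

lemma IsEven.normCount_odd [DiscreteTopology Λ] (hΛ : IsEven Λ) {k : ℕ} (hk : Odd k) :
    normCount Λ k = 0 := by
  refine (normCount_eq_zero_iff k).2 fun x hx hxk => ?_
  obtain ⟨m, hm⟩ := hΛ x hx
  rw [hm] at hxk
  have : 2 * m = (k : ℤ) := by exact_mod_cast hxk
  obtain ⟨r, rfl⟩ := hk
  omega

lemma qParam_two_sq (τ : ℍ) :
    Function.Periodic.qParam 2 (τ : ℂ) ^ 2 = Function.Periodic.qParam 1 (τ : ℂ) := by
  rw [Function.Periodic.qParam, Function.Periodic.qParam, ← Complex.exp_nat_mul]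
  congr 1
  push_cast
  ring

/-- The theta function of an even lattice is a power series in `exp(2 π i τ)`. -/
lemma IsEven.hasSum_thetaFn (he : IsEven Λ) (hΛ : IsUnimodular Λ) (τ : ℍ) :
    HasSum (fun k : ℕ => (normCount Λ (2 * k) : ℂ) • Function.Periodic.qParam 1 τ ^ k)
      (thetaFn Λ τ) := by
  have := hΛ.discrete
  have h : HasSum (fun k : ℕ => (normCount Λ k : ℂ) • Function.Periodic.qParam 2 τ ^ k)
      (thetaFn Λ τ) := hΛ.hasSum_thetaFn τ
  rw [← Function.Injective.hasSum_iff (mul_right_injective₀ (two_ne_zero' ℕ))] at h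
  · refine h.congr_fun fun k => ?_
    simp only [Function.comp_apply]
    rw [← qParam_two_sq, pow_mul]
  · intro k hk
    rw [he.normCount_odd, Nat.cast_zero, zero_smul]
    by_contra hk'
    rw [Nat.not_odd_iff_even, even_iff_two_dvd] at hk'
    exact hk ⟨hk'.choose, hk'.choose_spec.symm⟩

end Count

/-! ### The even case: weight twenty and level one -/

section Extremal

open ModularForm in
/-- The form `E₄⁵ - 1200 E₄² Δ` of weight twenty. -/
def extremalForm : ModularForm 𝒮ℒ 20 :=
  ModularForm.mcast (by norm_num) (E₄.pow 5) -
    (1200 / 1728 : ℂ) • (ModularForm.mcast (by norm_num) (E₄.pow 5) -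
      ModularForm.mcast (by norm_num) ((E₄.pow 2).mul (E₆.pow 2)))

lemma extremalForm_apply (τ : ℍ) : extremalForm τ =
    ModularForm.E₄ τ ^ 5 - 1200 * ModularForm.E₄ τ ^ 2 * ModularForm.discriminant τ := by
  rw [ModularForm.discriminant_eq_E₄_cube_sub_E₆_sq]
  simp only [extremalForm, _root_.sub_apply, ModularForm.coe_mcast, ModularForm.coe_pow,
    ModularForm.coe_mul, Pi.pow_apply, Pi.mul_apply, _root_.smul_apply, smul_eq_mul]
  ring

lemma E₄_qExpansion_coeff_two : (qExpansion 1 ModularForm.E₄).coeff 2 = 2160 := by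
  norm_num [EisensteinSeries.E_qExpansion_coeff _ ⟨2, rfl⟩,
    show bernoulli 4 = -1 / 30 by decide +kernel,
    show ArithmeticFunction.sigma 3 2 = 9 by decide +kernel]

lemma E₆_qExpansion_coeff_two : (qExpansion 1 ModularForm.E₆).coeff 2 = -16632 := by
  norm_num [EisensteinSeries.E_qExpansion_coeff _ ⟨3, rfl⟩,
    show bernoulli 6 = 1 / 42 by decide +kernel,
    show ArithmeticFunction.sigma 5 2 = 33 by decide +kernel]

/-- Writing Δ as (E₄³ - E₆²)/1728 reduces the coefficients to those of the two Eisenstein series. -/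
lemma extremalForm_qExpansion :
    qExpansion 1 extremalForm = qExpansion 1 ModularForm.E₄ ^ 5 -
      (1200 / 1728 : ℂ) • (qExpansion 1 ModularForm.E₄ ^ 5 -
        qExpansion 1 ModularForm.E₄ ^ 2 * qExpansion 1 ModularForm.E₆ ^ 2) := by
  rw [extremalForm, FunLike.coe_sub, ModularForm.qExpansion_sub one_pos one_mem_strictPeriods_SL,
    FunLike.coe_smul, ModularForm.qExpansion_smul one_pos one_mem_strictPeriods_SL,
    FunLike.coe_sub, ModularForm.qExpansion_sub one_pos one_mem_strictPeriods_SL,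
    ModularForm.coe_mcast, ModularForm.coe_mcast,
    ModularForm.qExpansion_mul one_pos one_mem_strictPeriods_SL,
    ModularForm.qExpansion_pow one_pos one_mem_strictPeriods_SL,
    ModularForm.qExpansion_pow one_pos one_mem_strictPeriods_SL,
    ModularForm.qExpansion_pow one_pos one_mem_strictPeriods_SL]

-- Here the variable is exp(2πiτ), so index m counts norm 2m. The constant 1200 = 5 · 240 is what
-- cancels the linear term of E₄⁵.
open ModularForm EisensteinSeries in
lemma extremalForm_qExpansion_coeff :
    (qExpansion 1 extremalForm).coeff 0 = 1 ∧ (qExpansion 1 extremalForm).coeff 1 = 0 ∧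
      (qExpansion 1 extremalForm).coeff 2 = 39600 := by
  rw [extremalForm_qExpansion]
  simp only [pow_succ, pow_zero, one_mul]
  refine ⟨?_, ?_, ?_⟩ <;>
  norm_num [PowerSeries.coeff_mul, Finset.Nat.antidiagonal_succ, E₄_qExpansion_coeff_one,
    E₆_qExpansion_coeff_one, E_qExpansion_coeff_zero _ ⟨2, rfl⟩, E₄_qExpansion_coeff_two,
    E₆_qExpansion_coeff_two, E_qExpansion_coeff_zero _ ⟨3, rfl⟩,
    -PowerSeries.coeff_zero_eq_constantCoeff]

variable {Λ : Submodule ℤ (Euc 40)}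

lemma IsExtremalEven.minNorm_eq (hΛ : IsExtremalEven Λ) : minNorm Λ = 4 := by
  rw [hΛ.2]
  norm_num

/-- The theta function of an extremal even unimodular lattice of dimension `40`. -/
theorem IsExtremalEven.thetaFn_eq (hΛ : IsExtremalEven Λ) : thetaFn Λ = extremalForm := by
  have hd := hΛ.1.1.discrete
  have he : ∀ γ : SL(2, ℤ), (extremalForm : ℍ → ℂ) ∣[(20 : ℤ)] γ = extremalForm := fun γ =>
    SlashInvariantFormClass.slash_action_eq extremalForm _ ⟨γ, rfl⟩
  -- Agreement at norms 0 and 2 means vanishing to order 2, and 20 < 2 · 12.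
  refine sub_eq_zero.1 (eq_zero_of_isBigO (k := 20) (sub_slash_of_eq hΛ.1.1.thetaFn_slash_S (he _))
    (sub_slash_of_eq (hΛ.1.2.thetaFn_slash_T _) (he _))
    ((mdifferentiable_thetaFn Λ).sub extremalForm.holo') 2 (by norm_num) ?_)
  have hsum : ∀ τ : ℍ, HasSum (fun m : ℕ => ((normCount Λ (2 * m) : ℂ) -
      (qExpansion 1 extremalForm).coeff m) • Function.Periodic.qParam 1 τ ^ m)
      ((thetaFn Λ - extremalForm) τ) := by
    intro τ
    simp_rw [sub_smul]
    exact (hΛ.1.2.hasSum_thetaFn hΛ.1.1 τ).sub (hasSum_qExpansion_levelOne extremalForm τ)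
  have := sub_sum_qSeries_isBigO one_pos hsum 2
  have h2 : normCount Λ 2 = 0 :=
    normCount_eq_zero_of_lt_minNorm two_pos (by rw [hΛ.minNorm_eq]; norm_num)
  obtain ⟨e0, e1, -⟩ := extremalForm_qExpansion_coeff
  refine (this.congr_left fun τ => ?_).congr_right fun τ => ?_
  · simp [Finset.sum_range_succ, normCount_zero, e0, e1, h2,
      -PowerSeries.coeff_zero_eq_constantCoeff]
  · simp

theorem IsExtremalEven.kissingNumber_eq (hΛ : IsExtremalEven Λ) : kissingNumber Λ = 39600 := by
  rw [SecrecyGain.kissingNumber_eq (m := 4) (by norm_num) hΛ.minNorm_eq]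
  have h := ModularFormClass.qExpansion_coeff_unique one_pos one_mem_strictPeriods_SL
    (f := extremalForm) (fun τ => by
      rw [← hΛ.thetaFn_eq]
      exact hΛ.1.2.hasSum_thetaFn hΛ.1.1 τ) 2
  rw [extremalForm_qExpansion_coeff.2.2] at h
  exact_mod_cast h

end Extremal

/-! ### Forms for the theta group -/

section ThetaGroup

lemma slash_neg_one {k : ℤ} (hk : Even k) (f : ℍ → ℂ) : f ∣[k] (-1 : SL(2, ℤ)) = f := by
  ext τ
  rw [ModularForm.SL_slash_apply, ModularGroup.SL_neg_smul, one_smul, ModularGroup.denom_apply]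
  simp [hk.neg.neg_one_zpow]

lemma slash_S_S {k : ℤ} (hk : Even k) (f : ℍ → ℂ) :
    (f ∣[k] ModularGroup.S) ∣[k] ModularGroup.S = f := by
  rw [← SlashAction.slash_mul, show ModularGroup.S * ModularGroup.S = -1 by decide,
    slash_neg_one hk]

/-- The relation TST = S⁻¹T⁻¹S shows that T fixes the conjugate f|TS, while it swaps f and f|T. So
SL(2, ℤ) permutes the three conjugates. -/
lemma slash_T_S_T {k : ℤ} {f : ℍ → ℂ} (hS : f ∣[k] ModularGroup.S = f)
    (hT : (f ∣[k] ModularGroup.T) ∣[k] ModularGroup.T = f) :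
    ((f ∣[k] ModularGroup.T) ∣[k] ModularGroup.S) ∣[k] ModularGroup.T =
      (f ∣[k] ModularGroup.T) ∣[k] ModularGroup.S := by
  have h1 : f ∣[k] ModularGroup.S⁻¹ = f := by
    conv_lhs => rw [← hS]
    rw [← SlashAction.slash_mul, mul_inv_cancel, SlashAction.slash_one]
  have h2 : f ∣[k] ModularGroup.T⁻¹ = f ∣[k] ModularGroup.T := by
    conv_lhs => rw [← hT]
    rw [← SlashAction.slash_mul, mul_inv_cancel, SlashAction.slash_one]
  have h3 : ModularGroup.T * (ModularGroup.S * ModularGroup.T) =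
      ModularGroup.S⁻¹ * ModularGroup.T⁻¹ * ModularGroup.S := by decide
  rw [← SlashAction.slash_mul, ← SlashAction.slash_mul, h3, SlashAction.slash_mul,
    SlashAction.slash_mul, h1, h2]

lemma tendsto_one_vadd_atImInfty :
    Tendsto (fun τ : ℍ => (1 : ℝ) +ᵥ τ) atImInfty atImInfty := by
  rw [atImInfty, tendsto_comap_iff]
  refine tendsto_comap.congr fun τ => ?_
  simp [vadd_im]

lemma isBigO_slash_T {f : ℍ → ℂ} {c : ℝ}
    (h : f =O[atImInfty] fun τ => rexp (c * τ.im)) (k : ℤ) :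
    (f ∣[k] ModularGroup.T) =O[atImInfty] fun τ => rexp (c * τ.im) := by
  refine (h.comp_tendsto tendsto_one_vadd_atImInfty).congr (fun τ => (slash_T_apply f k τ).symm)
    fun τ => ?_
  simp [vadd_im]

lemma mdifferentiable_slash {f : ℍ → ℂ} (hf : MDiff f) (k : ℤ) (γ : SL(2, ℤ)) :
    MDiff (f ∣[k] γ) := hf.slash k _

/-- A form of weight twenty for the theta group which is bounded at the cusp `1` and vanishes to
order six at infinity (in terms of `exp(π i τ)`) is zero. -/
lemma eq_zero_of_thetaGroup {f : ℍ → ℂ} (hS : f ∣[(20 : ℤ)] ModularGroup.S = f)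
    (hT : (f ∣[(20 : ℤ)] ModularGroup.T) ∣[(20 : ℤ)] ModularGroup.T = f) (hol : MDiff f)
    (hO : f =O[atImInfty] fun τ => rexp (-6 * π * τ.im))
    (hb : IsBoundedAtImInfty ((f ∣[(20 : ℤ)] ModularGroup.T) ∣[(20 : ℤ)] ModularGroup.S)) :
    f = 0 := by
  set g := f ∣[(20 : ℤ)] ModularGroup.T with hg
  set h := g ∣[(20 : ℤ)] ModularGroup.S with hh
  have hgol : MDiff g := mdifferentiable_slash hol _ _
  have hhol : MDiff h := mdifferentiable_slash hgol _ _
  -- The product of the conjugates has level one and weight 60. Both f and f|T are O(exp(-6π Im τ)),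
  -- giving order 6 in exp(2πiτ), and 60 < 6 · 12.
  have hprod : f * g * h = 0 := by
    refine eq_zero_of_isBigO (k := 60) ?_ ?_ ((hol.mul hgol).mul hhol) 6 (by norm_num) ?_
    · rw [mul_slash_of_eq (mul_slash_of_eq hS hh.symm rfl)
        (slash_S_S (by decide) g) (by norm_num)]
      ring
    · rw [mul_slash_of_eq (mul_slash_of_eq hg.symm hT rfl) (slash_T_S_T hS hT) (by norm_num)]
      ring
    · refine ((hO.mul (isBigO_slash_T hO 20)).mul hb).congr_right fun τ => ?_
      rw [Pi.one_apply, mul_one, ← Real.exp_add]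
      congr 1
      push_cast
      ring
  rcases (mul_eq_zero_iff (hol.mul hgol) hhol).1 hprod with h1 | h1
  · rcases (mul_eq_zero_iff hol hgol).1 h1 with h2 | h2
    · exact h2
    · exact (SlashAction.slash_eq_zero_iff _ _ _).1 h2
  · exact (SlashAction.slash_eq_zero_iff _ _ _).1 ((SlashAction.slash_eq_zero_iff _ _ _).1 h1)

end ThetaGroup

/-! ### The odd case: identification of the theta function -/

section Odd

lemma extremalForm_sub_isBigO :
    (fun τ => extremalForm τ - (1 + 39600 * Function.Periodic.qParam 2 (τ : ℂ) ^ 4))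
      =O[atImInfty] fun τ : ℍ => rexp (-6 * π * τ.im) := by
  obtain ⟨e0, e1, e2⟩ := extremalForm_qExpansion_coeff
  refine (sub_sum_qSeries_isBigO one_pos (hasSum_qExpansion_levelOne extremalForm) 3).congr
    (fun τ => ?_) fun τ => ?_
  · simp only [Finset.sum_range_succ, Finset.range_zero, Finset.sum_empty, e0, e1, e2,
      ← qParam_two_sq]
    ring
  · congr 1
    push_cast
    ring

/-- With q = exp(πiτ), the left-hand form is q⁵(θ₄ · `theta2Aux`)²⁰. The bracket tends to 2 with
error O(q), and 2²⁰ = 1048576. -/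
lemma theta_mul_pow_sub_isBigO :
    (fun τ => (theta4 τ ^ 4 * theta2 τ ^ 4) ^ 5 -
      1048576 * Function.Periodic.qParam 2 (τ : ℂ) ^ 5)
      =O[atImInfty] fun τ : ℍ => rexp (-6 * π * τ.im) := by
  set h : ℍ → ℂ := fun τ => theta4 τ * theta2Aux τ with hh
  have hlim : Tendsto h atImInfty (𝓝 2) := by simpa using tendsto_theta4.mul tendsto_theta2Aux
  have h1 : (fun τ => h τ - 2) =O[atImInfty] fun τ => rexp (-π * 1 * τ.im) := by
    have := (theta4_sub_one_isBigO.mul (tendsto_theta2Aux.isBigO_one ℝ)).congr_right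
      fun τ => mul_one _
    refine (this.add theta2Aux_sub_two_isBigO).congr_left fun τ => ?_
    simp only [hh]
    ring
  have h2 : (fun τ => ∑ i ∈ Finset.range 20, h τ ^ i * 2 ^ (20 - 1 - i)) =O[atImInfty]
      fun _ => (1 : ℝ) :=
    (tendsto_finsetSum _ fun i _ => (hlim.pow i).mul_const _).isBigO_one ℝ
  have h3 : (fun τ : ℍ => Function.Periodic.qParam 2 (τ : ℂ) ^ 5) =O[atImInfty]
      fun τ => rexp (-5 * π * τ.im) := by
    refine .of_bound 1 (Eventually.of_forall fun τ => le_of_eq ?_)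
    rw [norm_pow, norm_qParam_eq, Real.norm_of_nonneg (Real.exp_pos _).le, ← Real.exp_nat_mul,
      one_mul]
    congr 1
    push_cast
    ring
  refine (h3.mul (h2.mul h1)).congr (fun τ => ?_) fun τ => ?_
  · rw [geom_sum₂_mul, theta2_pow_four]
    simp only [hh]
    ring
  · rw [one_mul, ← Real.exp_add]
    congr 1
    ring

variable {Λ : Submodule ℤ (Euc 40)}

/-- The theta function of a unimodular lattice of dimension `40` whose theta series starts like
that of an extremal odd lattice. -/
theorem IsUnimodular.thetaFn_eq (hΛ : IsUnimodular Λ)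
    (h1 : normCount Λ 1 = 0) (h2 : normCount Λ 2 = 0) (h3 : normCount Λ 3 = 0)
    (h4 : normCount Λ 4 = 39600) (h5 : normCount Λ 5 = 1048576) :
    thetaFn Λ = extremalForm + (theta4 ^ 4 * theta2 ^ 4) ^ 5 := by
  have hd := hΛ.discrete
  set P : ℍ → ℂ := (theta4 ^ 4 * theta2 ^ 4) ^ 5 with hP
  -- `P'` and `P''` are the conjugates of `P` under T and TS; the signs come from the laws for
  -- fourth powers. Only fourth powers of θ₃ and θ₄ remain in `P''`, so it is bounded at infinity.
  set P' : ℍ → ℂ := (theta3 ^ 4 * -theta2 ^ 4) ^ 5 with hP'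
  set P'' : ℍ → ℂ := (-theta3 ^ 4 * theta4 ^ 4) ^ 5 with hP''
  have he : ∀ γ : SL(2, ℤ), (extremalForm : ℍ → ℂ) ∣[(20 : ℤ)] γ = extremalForm := fun γ =>
    SlashInvariantFormClass.slash_action_eq extremalForm _ ⟨γ, rfl⟩
  have hPS : P ∣[(20 : ℤ)] ModularGroup.S = P := by
    rw [pow_slash_of_eq (mul_slash_of_eq theta4_pow_slash_S theta2_pow_slash_S rfl) 5
      (by norm_num)]
    ring
  have hPT : P ∣[(20 : ℤ)] ModularGroup.T = P' :=
    pow_slash_of_eq (mul_slash_of_eq theta4_pow_slash_T theta2_pow_slash_T rfl) 5 (by norm_num)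
  have hn : (-theta2 ^ 4) ∣[(2 : ℤ)] ModularGroup.T = theta2 ^ 4 := by
    rw [SlashAction.neg_slash, theta2_pow_slash_T, neg_neg]
  have hn' : (-theta2 ^ 4) ∣[(2 : ℤ)] ModularGroup.S = theta4 ^ 4 := by
    rw [SlashAction.neg_slash, theta2_pow_slash_S, neg_neg]
  have hPTT : P' ∣[(20 : ℤ)] ModularGroup.T = P :=
    pow_slash_of_eq (mul_slash_of_eq theta3_pow_slash_T hn rfl) 5 (by norm_num)
  have hPTS : P' ∣[(20 : ℤ)] ModularGroup.S = P'' :=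
    pow_slash_of_eq (mul_slash_of_eq theta3_pow_slash_S hn' rfl) 5 (by norm_num)
  have hT : (thetaFn Λ - extremalForm - P) ∣[(20 : ℤ)] ModularGroup.T =
      thetaFn Λ ∣[(20 : ℤ)] ModularGroup.T - extremalForm - P' :=
    sub_slash_of_eq (sub_slash_of_eq rfl (he _)) hPT
  suffices thetaFn Λ - extremalForm - P = 0 by
    rw [sub_sub, sub_eq_zero] at this
    exact this
  refine eq_zero_of_thetaGroup ?_ ?_ ?_ ?_ ?_
  · exact sub_slash_of_eq (sub_slash_of_eq hΛ.thetaFn_slash_S (he _)) hPS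
  · rw [hT]
    exact sub_slash_of_eq (sub_slash_of_eq (hΛ.thetaFn_slash_T_T _) (he _)) hPTT
  · exact ((mdifferentiable_thetaFn Λ).sub extremalForm.holo').sub
      ((mdifferentiable_theta4_pow.mul mdifferentiable_theta2_pow).pow 5)
  · have hsum : ∀ τ : ℍ, HasSum (fun k : ℕ => (normCount Λ k : ℂ) •
        Function.Periodic.qParam 2 τ ^ k) (thetaFn Λ τ) := hΛ.hasSum_thetaFn
    have hO : (fun τ => thetaFn Λ τ - (1 + 39600 * Function.Periodic.qParam 2 (τ : ℂ) ^ 4 +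
        1048576 * Function.Periodic.qParam 2 (τ : ℂ) ^ 5))
        =O[atImInfty] fun τ : ℍ => rexp (-6 * π * τ.im) := by
      refine (sub_sum_qSeries_isBigO two_pos hsum 6).congr (fun τ => ?_) fun τ => ?_
      · simp only [Finset.sum_range_succ, Finset.range_zero, Finset.sum_empty, normCount_zero, h1,
          h2, h3, h4, h5]
        push_cast
        ring
      · congr 1
        push_cast
        ring
    refine ((hO.sub extremalForm_sub_isBigO).sub theta_mul_pow_sub_isBigO).congr_left fun τ => ?_
    simp only [hP, Pi.sub_apply, Pi.pow_apply, Pi.mul_apply]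
    ring
  · rw [hT, sub_slash_of_eq (sub_slash_of_eq rfl (he _)) hPTS]
    have hb := ModularFormClass.bdd_at_infty extremalForm
    have hb' : IsBoundedAtImInfty P'' :=
      (((tendsto_theta3_pow.neg.mul tendsto_theta4_pow).pow 5).isBigO_one ℝ)
    exact (hΛ.isBoundedAtImInfty_shadow.sub hb).sub hb'

end Odd

/-! ### The theta function of ℤⁿ as a power of θ₃ -/

section IntLattice

lemma hasSum_prod_fin {f : ℤ → ℂ} (hf : Summable fun k => ‖f k‖) (n : ℕ) :
    (Summable fun w : Fin n → ℤ => ‖∏ i, f (w i)‖) ∧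
      ∑' w : Fin n → ℤ, ∏ i, f (w i) = (∑' k, f k) ^ n := by
  induction n with
  | zero => exact ⟨(hasSum_fintype _).summable, by simp⟩
  | succ n ih =>
    let e : ℤ × (Fin n → ℤ) ≃ (Fin (n + 1) → ℤ) := Fin.consEquiv fun _ => ℤ
    let g : (Fin n → ℤ) → ℂ := fun w => ∏ i, f (w i)
    have hg : Summable fun w => ‖g w‖ := ih.1
    have he : ∀ p : ℤ × (Fin n → ℤ), ∏ i, f (e p i) = f p.1 * g p.2 := fun p =>
      Fin.prod_univ_succ _
    constructor
    · rw [← e.summable_iff]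
      exact (hf.mul_norm hg).congr fun p => (congrArg _ (he p)).symm
    · rw [← e.tsum_eq, tsum_congr he, ← tsum_mul_tsum_of_summable_norm hf hg, pow_succ', ← ih.2]

/-- The theta function of the integer lattice. -/
lemma theta_intLattice (n : ℕ) (τ : ℍ) : theta (intLattice n) τ = theta3 τ ^ n := by
  set B := (EuclideanSpace.basisFun (Fin n) ℝ).toBasis
  have hspan : intLattice n = Submodule.span ℤ (Set.range B) := by
    rw [intLattice, OrthonormalBasis.coe_toBasis]
  rw [hspan]
  set b := B.restrictScalars ℤ
  have hnorm : ∀ w : Fin n → ℤ, ‖((b.equivFun.symm w : _) : Euc n)‖ ^ 2 = ∑ i, (w i : ℝ) ^ 2 := by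
    intro w
    rw [EuclideanSpace.norm_sq_eq]
    refine Finset.sum_congr rfl fun i _ => ?_
    have := B.restrictScalars_repr_apply ℤ (b.equivFun.symm w) i
    rw [OrthonormalBasis.coe_toBasis_repr_apply, EuclideanSpace.basisFun_repr,
      ← Module.Basis.equivFun_apply, LinearEquiv.apply_symm_apply] at this
    rw [← this, Real.norm_eq_abs, sq_abs]
    rfl
  have hs := (summable_expSum_term (a := fun _ : ℤ => 1) (by simp) summable_exp_int_sq τ).norm
  rw [theta, theta3, expSum, ← (hasSum_prod_fin hs n).2,
    ← b.equivFun.symm.toEquiv.tsum_eq]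
  refine tsum_congr fun w => ?_
  simp only [one_mul, ← Complex.exp_sum]
  congr 1
  rw [← Finset.sum_mul, ← Finset.mul_sum, LinearEquiv.coe_toEquiv, hnorm]
  push_cast
  rfl

end IntLattice

/-! ### Maximising the secrecy function -/

section Secrecy

/-- The point `i y`. -/
abbrev imPoint (y : ℝ) (hy : 0 < y) : ℍ := ⟨y * Complex.I, by simpa using hy⟩

lemma exists_ofReal_expSum {ι : Type*} {a : ι → ℂ} {k : ι → ℝ} (ha : ∀ i, ∃ r : ℝ, a i = r) {y : ℝ}
    (hy : 0 < y) : ∃ r : ℝ, expSum a k (imPoint y hy) = r := by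
  choose r hr using ha
  refine ⟨∑' i, r i * rexp (-π * k i * y), ?_⟩
  rw [expSum, Complex.ofReal_tsum]
  refine tsum_congr fun i => ?_
  rw [hr]
  push_cast
  congr 2
  linear_combination (π * k i * y : ℂ) * Complex.I_sq

lemma exists_ofReal_exp_pi_I (n : ℤ) : ∃ r : ℝ, Complex.exp (π * Complex.I * n) = r := by
  refine ⟨(-1) ^ n, ?_⟩
  rw [mul_comm, Complex.exp_int_mul, Complex.exp_pi_mul_I]
  push_cast
  rfl

/-- The values of the theta constants on the imaginary axis. -/
lemma exists_theta_values {y : ℝ} (hy : 0 < y) :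
    ∃ a b c : ℝ, theta3 (imPoint y hy) ^ 4 = a ∧ theta4 (imPoint y hy) ^ 4 = b ∧
      theta2 (imPoint y hy) ^ 4 = c ∧ a = b + c ∧ 0 < a ∧ 0 ≤ b ∧ 0 ≤ c := by
  obtain ⟨r, hr⟩ : ∃ r : ℝ, theta3 (imPoint y hy) = r :=
    exists_ofReal_expSum (fun _ => ⟨1, by simp⟩) hy
  obtain ⟨s, hs⟩ : ∃ s : ℝ, theta4 (imPoint y hy) = s :=
    exists_ofReal_expSum exists_ofReal_exp_pi_I hy
  obtain ⟨t, ht⟩ : ∃ t : ℝ, theta2 (imPoint y hy) = t := by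
    obtain ⟨t, ht⟩ : ∃ t : ℝ, theta2Aux (imPoint y hy) = t :=
      exists_ofReal_expSum (fun _ => ⟨1, by simp⟩) hy
    refine ⟨rexp (-π * y / 4) * t, ?_⟩
    rw [theta2, ht]
    push_cast
    congr 2
    linear_combination (π * y / 4 : ℂ) * Complex.I_sq
  have hJ := congrFun theta3_pow_eq (imPoint y hy)
  simp only [Pi.pow_apply, Pi.add_apply, hr, hs, ht] at hJ
  refine ⟨r ^ 4, s ^ 4, t ^ 4, by simp [hr], by simp [hs], by simp [ht], by exact_mod_cast hJ, ?_,
    by positivity, by positivity⟩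
  -- θ₃ is a factor of Δ, which has no zeros; this makes θ₃⁴ strictly positive.
  have hΔ := ModularForm.discriminant_ne_zero (imPoint y hy)
  rw [discriminant_eq_theta, hr] at hΔ
  have : r ≠ 0 := by
    rintro rfl
    simp at hΔ
  positivity

/-- The point i is fixed by S, which exchanges θ₄⁴ and θ₂⁴; the factor i⁻² cancels the sign. -/
lemma theta_values_one : theta4 (imPoint 1 one_pos) ^ 4 = theta2 (imPoint 1 one_pos) ^ 4 := by
  have h := congrFun theta4_pow_slash_S (imPoint 1 one_pos)
  rw [SlashInvariantForm.slash_S_apply] at h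
  have hI : (imPoint 1 one_pos : ℂ) = Complex.I := by simp
  have hp : (⟨(-(imPoint 1 one_pos : ℂ))⁻¹, (imPoint 1 one_pos).im_inv_neg_coe_pos⟩ : ℍ) =
      imPoint 1 one_pos := by
    ext
    rw [coe_mk, hI]
    simp
  rw [hp, hI] at h
  simp only [Pi.pow_apply, Pi.neg_apply] at h
  rw [zpow_neg, show (2 : ℤ) = ((2 : ℕ) : ℤ) by rfl, zpow_natCast, Complex.I_sq] at h
  linear_combination -h

/-- The reciprocal of the secrecy function, as a function of the square of the modulus. -/
def gainPoly (c u : ℝ) : ℝ := (1 - u) ^ 5 - 75 / 16 * (1 - u) ^ 2 * u ^ 2 + c * u ^ 5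

lemma gainPoly_quarter (c : ℝ) : gainPoly c (1 / 4) = (297 + 4 * c) / 4096 := by
  rw [gainPoly]
  ring

/-- In terms of v = u(1 - u), (1 - u)⁵ + u⁵ = 1 - 5v + 5v², so the polynomial is 1 - 5v + (5/16)v² -
(1 - c)u⁵. For c ≤ 1 it decreases on [0, 1/4], where v ≤ 3/16. -/
lemma gainPoly_quarter_le {c u : ℝ} (hc : c ≤ 1) (h0 : 0 ≤ u) (h1 : u ≤ 1 / 4) :
    gainPoly c (1 / 4) ≤ gainPoly c u := by
  have hv : u * (1 - u) ≤ 3 / 16 := by nlinarith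
  have hv0 : 0 ≤ u * (1 - u) := mul_nonneg h0 (by linarith)
  have hu : (1 - c) * u ^ 5 ≤ (1 - c) * (1 / 4) ^ 5 :=
    mul_le_mul_of_nonneg_left (pow_le_pow_left₀ h0 h1 5) (by linarith)
  have key : gainPoly c u =
      1 - 5 * (u * (1 - u)) + 5 / 16 * (u * (1 - u)) ^ 2 - (1 - c) * u ^ 5 := by
    rw [gainPoly]
    ring
  rw [gainPoly_quarter, key]
  nlinarith

variable {Λ : Submodule ℤ (Euc 40)}

/-- For a = θ₃⁴, b = θ₄⁴, d = θ₂⁴ and u = bd/a², Jacobi's identity gives E₄ = a²(1 - u) and Δ =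
a⁶u²/256, whence the coefficient 1200/256 = 75/16. The bound u ≤ 1/4 is (b - d)² ≥ 0. -/
lemma exists_secrecyFunction_eq {c : ℝ}
    (hΛ : ∀ τ, thetaFn Λ τ = extremalForm τ + c * (theta4 τ ^ 4 * theta2 τ ^ 4) ^ 5)
    {y : ℝ} (hy : 0 < y) :
    ∃ u : ℝ, 0 ≤ u ∧ u ≤ 1 / 4 ∧ secrecyFunction Λ y = 1 / gainPoly c u ∧ (y = 1 → u = 1 / 4) := by
  obtain ⟨a, b, d, ha, hb, hd, hJ, ha0, hb0, hd0⟩ := exists_theta_values hy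
  refine ⟨b * d / a ^ 2, by positivity, ?_, ?_, ?_⟩
  · rw [div_le_iff₀ (by positivity), hJ]
    nlinarith [sq_nonneg (b - d)]
  · rw [← Complex.ofReal_inj, ofReal_secrecyFunction]
    have h1 := theta_intLattice 40 (imPoint y hy)
    have h2 := hΛ (imPoint y hy)
    have hE := congrFun E₄_eq_theta (imPoint y hy)
    simp only [Pi.smul_apply, Pi.add_apply, Pi.pow_apply, ha, hb, hd, smul_eq_mul] at hE
    rw [extremalForm_apply, discriminant_eq_theta, hE, ha, hb, hd] at h2
    rw [show theta3 (imPoint y hy) ^ 40 = (theta3 (imPoint y hy) ^ 4) ^ 10 by ring, ha] at h1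
    have h3 : thetaFn Λ (imPoint y hy) = ((a ^ 10 * gainPoly c (b * d / a ^ 2) : ℝ) : ℂ) := by
      have key : a ^ 10 * gainPoly c (b * d / a ^ 2) = (2⁻¹ * (a ^ 2 + b ^ 2 + d ^ 2)) ^ 5 -
          1200 * (2⁻¹ * (a ^ 2 + b ^ 2 + d ^ 2)) ^ 2 * ((a * b * d) ^ 2 / 256) +
          c * (b * d) ^ 5 := by
        rw [gainPoly, show a ^ 2 + b ^ 2 + d ^ 2 = 2 * (a ^ 2 - b * d) by rw [hJ]; ring]
        field_simp
        ring
      rw [h2, key]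
      push_cast
      ring
    change theta (intLattice 40) (y * Complex.I) = _ at h1
    change theta Λ (y * Complex.I) = _ at h3
    rw [h1, h3]
    push_cast
    have : (a : ℂ) ≠ 0 := by exact_mod_cast ha0.ne'
    rw [mul_comm, ← div_div, div_right_comm, div_self (pow_ne_zero _ this)]
  · rintro rfl
    have hbd : b = d := by
      have := theta_values_one
      rw [hb, hd] at this
      exact_mod_cast this
    subst hbd
    have hb : b ≠ 0 := by
      rintro rfl
      simp [hJ] at ha0
    rw [hJ]
    field_simp
    norm_num

theorem secrecyFunction_max {c : ℝ} (hc0 : 0 ≤ c) (hc : c ≤ 1)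
    (hΛ : ∀ τ, thetaFn Λ τ = extremalForm τ + c * (theta4 τ ^ 4 * theta2 τ ^ 4) ^ 5) :
    IsMaxOn (secrecyFunction Λ) (Set.Ioi 0) 1 ∧ secrecyGain Λ = 4096 / (297 + 4 * c) := by
  have h1 : secrecyFunction Λ 1 = 4096 / (297 + 4 * c) := by
    obtain ⟨u, -, -, h, hu⟩ := exists_secrecyFunction_eq hΛ one_pos
    rw [h, hu rfl, gainPoly_quarter, one_div_div]
  have hmax : IsMaxOn (secrecyFunction Λ) (Set.Ioi 0) 1 := by
    intro y hy
    obtain ⟨u, hu0, hu1, h, -⟩ := exists_secrecyFunction_eq hΛ hy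
    have := gainPoly_quarter_le hc hu0 hu1
    rw [gainPoly_quarter] at this
    rw [Set.mem_ofPred_eq, h1, h, ← one_div_div (297 + 4 * c)]
    exact one_div_le_one_div_of_le (by positivity) this
  refine ⟨hmax, ?_⟩
  rw [← h1, secrecyGain]
  exact IsGreatest.csSup_eq ⟨⟨1, Set.mem_Ioi.2 one_pos, rfl⟩, by
    rintro _ ⟨y, hy, rfl⟩
    exact hmax hy⟩

end Secrecy

/-! ### A doubly even self-dual code of length 40 -/

section Code

open Matrix

/-- The weight of a binary word. -/
def weight {ι : Type*} [Fintype ι] (c : ι → ZMod 2) : ℕ := ∑ i, (c i).val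

variable {ι : Type*} [Fintype ι]

lemma weight_add (c c' : ι → ZMod 2) :
    weight (c + c') + 2 * weight (c * c') = weight c + weight c' := by
  simp only [weight, Finset.mul_sum, ← Finset.sum_add_distrib]
  refine Finset.sum_congr rfl fun i _ => ?_
  simp only [Pi.add_apply, Pi.mul_apply]
  generalize c i = a
  generalize c' i = b
  revert a b
  decide

lemma natCast_weight (c : ι → ZMod 2) : (weight c : ZMod 2) = ∑ i, c i := by
  simp [weight]

lemma weight_eq_zero {c : ι → ZMod 2} : weight c = 0 ↔ c = 0 := by
  simp [weight, funext_iff]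

lemma exists_weight_eq_succ [DecidableEq ι] {c : ι → ZMod 2} (hc : c ≠ 0) :
    ∃ i c', c = c' + Pi.single i 1 ∧ weight c = weight c' + 1 := by
  obtain ⟨i, hi⟩ := Function.ne_iff.1 hc
  have h1 : ∀ a : ZMod 2, a ≠ 0 → a = 1 := by decide
  have hi1 : c i = 1 := h1 _ hi
  have h2 : ∀ a : ZMod 2, a + a = 0 := by decide
  refine ⟨i, c + Pi.single i 1, ?_, ?_⟩
  · rw [add_assoc, show (Pi.single i 1 + Pi.single i 1 : ι → ZMod 2) = 0 from funext fun _ => h2 _,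
      add_zero]
  · have h := weight_add c (Pi.single i 1)
    have hs : weight (Pi.single i 1 : ι → ZMod 2) = 1 := by
      rw [weight, Finset.sum_eq_single i] <;> simp +contextual [ZMod.val_one]
    have hp : c * Pi.single i 1 = Pi.single i 1 := by
      ext j
      rcases eq_or_ne j i with rfl | hj
      · simp [hi1]
      · simp [hj]
    rw [hp, hs] at h
    omega

/-- The circulant matrix generating the code. -/
def codeMatrix : Matrix (Fin 20) (Fin 20) (ZMod 2) :=
  Matrix.of fun i j => if j - i ∈ [0, 1, 2, 6, 7, 9, 10] then 1 else 0

/-- Each nonzero residue modulo 20 is a difference of two elements of the defining set an even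
number of times, and the set has odd size 7. -/
lemma codeMatrix_mul_transpose : codeMatrix * codeMatrixᵀ = 1 := by
  have h : ∀ i j, ∑ k, codeMatrix i k * codeMatrix j k = if i = j then 1 else 0 := by
    decide +kernel
  ext i j
  rw [Matrix.one_apply, ← h]
  rfl

lemma weight_codeMatrix (i : Fin 20) : weight (codeMatrix i) = 7 := by
  revert i
  decide +kernel

lemma weight_codeMatrix_transpose (i : Fin 20) : weight (codeMatrixᵀ i) = 7 := by
  revert i
  decide +kernel

lemma weight_codeMatrix_add {i j : Fin 20} (h : i ≠ j) :
    6 ≤ weight (codeMatrix i + codeMatrix j) := by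
  revert i j
  decide +kernel

lemma weight_codeMatrix_transpose_add {i j : Fin 20} (h : i ≠ j) :
    6 ≤ weight (codeMatrixᵀ i + codeMatrixᵀ j) := by
  revert i j
  decide +kernel

/-- One row contributes 1 + 7, the sum of two distinct rows at least 2 + 6. -/
lemma eight_le_weight_add {A : Matrix (Fin 20) (Fin 20) (ZMod 2)}
    (h1 : ∀ i, weight (A i) = 7) (h2 : ∀ i j, i ≠ j → 6 ≤ weight (A i + A j))
    {u : Fin 20 → ZMod 2} (h0 : u ≠ 0) (hu : weight u ≤ 2) : 8 ≤ weight u + weight (u ᵥ* A) := by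
  obtain ⟨i, v, rfl, hv⟩ := exists_weight_eq_succ h0
  rcases eq_or_ne v 0 with rfl | hv0
  · rw [hv, zero_add, single_one_vecMul, row, h1]
    omega
  · obtain ⟨j, w, rfl, hw⟩ := exists_weight_eq_succ hv0
    have hw0 : w = 0 := weight_eq_zero.1 (by omega)
    subst hw0
    have hij : i ≠ j := by
      rintro rfl
      have : (0 + Pi.single i 1 + Pi.single i 1 : Fin 20 → ZMod 2) = 0 := by
        rw [zero_add]
        exact funext fun _ => (by decide : ∀ a : ZMod 2, a + a = 0) _
      exact h0 this
    have := h2 j i hij.symm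
    rw [hv, hw, zero_add, add_vecMul, single_one_vecMul, single_one_vecMul, row]
    omega

lemma sum_fin_forty {M : Type*} [AddCommMonoid M] (f : Fin 40 → M) :
    ∑ i, f i = ∑ i : Fin 20, f (Fin.castAdd 20 i) + ∑ i : Fin 20, f (Fin.natAdd 20 i) :=
  Fin.sum_univ_add (a := 20) (b := 20) f

lemma forall_fin_forty {p : Fin 40 → Prop} (h1 : ∀ i : Fin 20, p (Fin.castAdd 20 i))
    (h2 : ∀ i : Fin 20, p (Fin.natAdd 20 i)) (i : Fin 40) : p i :=
  Fin.addCases (m := 20) (n := 20) h1 h2 i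

/-- The encoder of the double circulant code of length `40`. -/
def encode : (Fin 20 → ZMod 2) →ₗ[ZMod 2] (Fin 40 → ZMod 2) where
  toFun u := Fin.append u (u ᵥ* codeMatrix)
  map_add' u v := by
    refine funext (forall_fin_forty (fun i => ?_) fun i => ?_)
    · simp only [Pi.add_apply, Fin.append_left]
    · rw [Pi.add_apply, Fin.append_right, Fin.append_right, Fin.append_right, add_vecMul,
        Pi.add_apply]
  map_smul' a u := by
    refine funext (forall_fin_forty (fun i => ?_) fun i => ?_)
    · simp only [Pi.smul_apply, Fin.append_left, RingHom.id_apply]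
    · rw [Pi.smul_apply, Fin.append_right, Fin.append_right, smul_vecMul, Pi.smul_apply,
        RingHom.id_apply]

lemma encode_castAdd (u : Fin 20 → ZMod 2) (i : Fin 20) : encode u (Fin.castAdd 20 i) = u i :=
  Fin.append_left _ _ i

lemma encode_natAdd (u : Fin 20 → ZMod 2) (i : Fin 20) :
    encode u (Fin.natAdd 20 i) = (u ᵥ* codeMatrix) i :=
  Fin.append_right _ _ i

lemma sum_encode_mul (u : Fin 20 → ZMod 2) (c : Fin 40 → ZMod 2) :
    ∑ i, encode u i * c i = u ⬝ᵥ (fun i => c (Fin.castAdd 20 i)) +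
      u ᵥ* codeMatrix ⬝ᵥ fun i => c (Fin.natAdd 20 i) := by
  rw [sum_fin_forty]
  simp only [encode_castAdd, encode_natAdd, dotProduct]

lemma weight_encode (u : Fin 20 → ZMod 2) :
    weight (encode u) = weight u + weight (u ᵥ* codeMatrix) := by
  rw [weight, sum_fin_forty]
  simp only [encode_castAdd, encode_natAdd, weight]

lemma sum_encode_mul_encode (u v : Fin 20 → ZMod 2) : ∑ i, encode u i * encode v i = 0 := by
  rw [sum_encode_mul]
  simp only [encode_castAdd, encode_natAdd]
  change u ⬝ᵥ v + u ᵥ* codeMatrix ⬝ᵥ v ᵥ* codeMatrix = 0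
  rw [← mulVec_transpose codeMatrix v, ← dotProduct_mulVec, mulVec_mulVec,
    codeMatrix_mul_transpose, one_mulVec]
  exact (by decide : ∀ a : ZMod 2, a + a = 0) _

/-- Each generator has weight 1 + 7 = 8. Adding a codeword changes the weight by twice an overlap
that is even by self-orthogonality, so divisibility by 4 persists. -/
lemma four_dvd_weight_encode (u : Fin 20 → ZMod 2) : 4 ∣ weight (encode u) := by
  rw [← Finset.univ_sum_single u]
  induction (Finset.univ : Finset (Fin 20)) using Finset.induction_on with
  | empty => simp [weight]
  | insert i s hi ih =>
    rw [Finset.sum_insert hi, map_add]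
    set v := ∑ x ∈ s, Pi.single x (u x)
    have h1 : 4 ∣ weight (encode (Pi.single i (u i))) := by
      rcases (by decide : ∀ a : ZMod 2, a = 0 ∨ a = 1) (u i) with h | h
      · simp [h, weight]
      · rw [h, weight_encode, single_one_vecMul, row, weight_codeMatrix]
        have : weight (Pi.single i 1 : Fin 20 → ZMod 2) = 1 := by
          rw [weight, Finset.sum_eq_single i] <;> simp +contextual [ZMod.val_one]
        rw [this]
        norm_num
    have h2 := weight_add (encode (Pi.single i (u i))) (encode v)
    have h3 : 2 ∣ weight (encode (Pi.single i (u i)) * encode v) := by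
      rw [← ZMod.natCast_eq_zero_iff, natCast_weight]
      exact sum_encode_mul_encode _ _
    omega

lemma encode_injective : Function.Injective encode := by
  intro u v h
  ext i
  rw [← encode_castAdd u, h, encode_castAdd]

/-- The double circulant code of length `40`. -/
def code : Submodule (ZMod 2) (Fin 40 → ZMod 2) := LinearMap.range encode

lemma ncard_code : (code : Set (Fin 40 → ZMod 2)).ncard = 2 ^ 20 := by
  rw [code, LinearMap.coe_range, ← Set.image_univ, Set.ncard_image_of_injective _ encode_injective,
    Set.ncard_univ]
  simp [Nat.card_eq_fintype_card]

lemma four_dvd_weight {c : Fin 40 → ZMod 2} (hc : c ∈ code) : 4 ∣ weight c := by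
  obtain ⟨u, rfl⟩ := hc
  exact four_dvd_weight_encode u

lemma sum_mul_eq_zero {c c' : Fin 40 → ZMod 2} (hc : c ∈ code) (hc' : c' ∈ code) :
    ∑ i, c i * c' i = 0 := by
  obtain ⟨u, rfl⟩ := hc
  obtain ⟨v, rfl⟩ := hc'
  exact sum_encode_mul_encode u v

lemma transpose_mul_eq_one {R : Type*} [CommRing R] [DecidableEq ι] {A : Matrix ι ι R}
    (h : A * Aᵀ = 1) : Aᵀ * A = 1 := mul_eq_one_comm.1 h

lemma codeMatrix_transpose_mul : codeMatrixᵀ * codeMatrix = 1 :=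
  transpose_mul_eq_one codeMatrix_mul_transpose

/-- Orthogonality to the generators says x = Ay for the two halves x, y of the word, and AᵀA = 1
turns this into y = xA. -/
lemma mem_code_of_dual {c : Fin 40 → ZMod 2} (h : ∀ c' ∈ code, ∑ i, c' i * c i = 0) :
    c ∈ code := by
  obtain ⟨x, hx⟩ : ∃ x : Fin 20 → ZMod 2, x = fun i => c (Fin.castAdd 20 i) := ⟨_, rfl⟩
  obtain ⟨y, hy⟩ : ∃ y : Fin 20 → ZMod 2, y = fun i => c (Fin.natAdd 20 i) := ⟨_, rfl⟩
  have h1 : x = codeMatrix *ᵥ y := by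
    ext i
    have := h _ ⟨Pi.single i 1, rfl⟩
    rw [sum_encode_mul, ← hx, ← hy, single_one_dotProduct, ← dotProduct_mulVec,
      single_one_dotProduct] at this
    exact (by decide : ∀ a b : ZMod 2, a + b = 0 → a = b) _ _ this
  have h2 : x ᵥ* codeMatrix = y := by
    rw [h1, ← mulVec_transpose, mulVec_mulVec, codeMatrix_transpose_mul, one_mulVec]
  refine ⟨x, funext (forall_fin_forty (fun i => ?_) fun i => ?_)⟩
  · rw [encode_castAdd, hx]
  · rw [encode_natAdd, h2, hy]

lemma one_mem_code : (1 : Fin 40 → ZMod 2) ∈ code := by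
  refine mem_code_of_dual fun c hc => ?_
  simp only [Pi.one_apply, mul_one]
  rw [← natCast_weight, ZMod.natCast_eq_zero_iff]
  exact (by norm_num : 2 ∣ 4).trans (four_dvd_weight hc)

/-- If one half has weight at most 2, the row estimates apply to A or to its transpose, since A is
orthogonal. Otherwise the weight is at least 6, hence at least 8 by divisibility by 4. -/
lemma eight_le_weight {c : Fin 40 → ZMod 2} (hc : c ∈ code) (h0 : c ≠ 0) : 8 ≤ weight c := by
  obtain ⟨u, rfl⟩ := hc
  have hu : u ≠ 0 := by
    rintro rfl
    exact h0 (map_zero _)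
  have h4 := four_dvd_weight_encode u
  rw [weight_encode] at h4 ⊢
  rcases le_or_gt (weight u) 2 with h | h
  · exact eight_le_weight_add weight_codeMatrix (fun _ _ => weight_codeMatrix_add) hu h
  · set v := u ᵥ* codeMatrix with hv
    have huv : v ᵥ* codeMatrixᵀ = u := by
      rw [hv, vecMul_vecMul, codeMatrix_mul_transpose, vecMul_one]
    rcases le_or_gt (weight v) 2 with h' | h'
    · have hv0 : v ≠ 0 := by
        intro hv0
        rw [hv0, zero_vecMul] at huv
        exact hu huv.symm
      have := eight_le_weight_add weight_codeMatrix_transpose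
        (fun _ _ => weight_codeMatrix_transpose_add) hv0 h'
      rw [huv] at this
      omega
    · omega

end Code

/-! ### Integer vectors over the code, and glueing -/

section CodeVectors

open Matrix

/-- Reduction modulo two of integer vectors. -/
def modTwo : (Fin 40 → ℤ) →ₗ[ℤ] (Fin 40 → ZMod 2) where
  toFun w i := (w i : ZMod 2)
  map_add' _ _ := funext fun _ => Int.cast_add _ _
  map_smul' k w := funext fun i => by simp

lemma modTwo_apply (w : Fin 40 → ℤ) (i : Fin 40) : modTwo w i = (w i : ZMod 2) := rfl

/-- The integer vectors reducing to the code whose coordinate sum is divisible by four. -/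
def codeVectors : Submodule ℤ (Fin 40 → ℤ) where
  carrier := {w | modTwo w ∈ code ∧ (4 : ℤ) ∣ ∑ i, w i}
  zero_mem' := ⟨by rw [map_zero]; exact code.zero_mem, by simp⟩
  add_mem' {v w} hv hw := ⟨by rw [map_add]; exact code.add_mem hv.1 hw.1, by
    simp only [Pi.add_apply, Finset.sum_add_distrib]
    exact dvd_add hv.2 hw.2⟩
  smul_mem' k w hw := ⟨by rw [map_smul]; exact zsmul_mem hw.1 k, by
    simp only [Pi.smul_apply, smul_eq_mul, ← Finset.mul_sum]
    exact hw.2.mul_left k⟩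

variable {v w g y z : Fin 40 → ℤ}

lemma two_dvd_dotProduct (hv : v ∈ codeVectors) (hw : w ∈ codeVectors) : 2 ∣ v ⬝ᵥ w := by
  refine (ZMod.intCast_zmod_eq_zero_iff_dvd _ 2).1 ?_
  simpa [dotProduct, modTwo_apply] using sum_mul_eq_zero hv.1 hw.1

lemma val_modTwo (a : ℤ) : ∃ m : ℤ, 0 ≤ m ∧ a ^ 2 = ((a : ZMod 2).val : ℤ) + 4 * m := by
  rcases Int.even_or_odd' a with ⟨b, rfl | rfl⟩
  · refine ⟨b ^ 2, by positivity, ?_⟩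
    have : (((2 * b : ℤ) : ZMod 2)).val = 0 := by
      rw [ZMod.val_eq_zero, ZMod.intCast_zmod_eq_zero_iff_dvd _ 2]
      exact ⟨b, rfl⟩
    rw [this]
    push_cast
    ring
  · refine ⟨b ^ 2 + b, ?_, ?_⟩
    · rcases le_or_gt 0 b with h | h
      · positivity
      · nlinarith
    · have h0 : ((2 * b : ℤ) : ZMod 2) = 0 := by
        rw [ZMod.intCast_zmod_eq_zero_iff_dvd _ 2]
        exact ⟨b, rfl⟩
      have : (((2 * b + 1 : ℤ) : ZMod 2)).val = 1 := by
        rw [Int.cast_add, h0, zero_add, Int.cast_one, ZMod.val_one]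
      rw [this]
      push_cast
      ring

lemma dotProduct_self_eq (w : Fin 40 → ℤ) :
    ∃ m : ℤ, 0 ≤ m ∧ w ⬝ᵥ w = (weight (modTwo w) : ℤ) + 4 * m := by
  choose m hm0 hm using val_modTwo
  refine ⟨∑ i, m (w i), Finset.sum_nonneg fun i _ => hm0 _, ?_⟩
  rw [weight, Nat.cast_sum, Finset.mul_sum, ← Finset.sum_add_distrib, dotProduct]
  refine Finset.sum_congr rfl fun i _ => ?_
  rw [← sq, hm]
  rfl

lemma four_dvd_dotProduct_self (hw : w ∈ codeVectors) : 4 ∣ w ⬝ᵥ w := by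
  obtain ⟨m, -, hm⟩ := dotProduct_self_eq w
  have : (4 : ℤ) ∣ weight (modTwo w) := by exact_mod_cast four_dvd_weight hw.1
  omega

lemma exists_eq_two_smul (h : ∀ i, Even (w i)) : ∃ v, w = (2 : ℤ) • v := by
  choose v hv using fun i => (h i).two_dvd
  exact ⟨v, funext hv⟩

/-- A nonzero residue is a codeword of weight at least 8. If w = 2v, the only multiple of 4 to
exclude is 4; it would force v · v = 1, hence an odd coordinate sum of v, so that the sum of w is
not divisible by 4. -/
lemma eight_le_dotProduct_self (hw : w ∈ codeVectors) (h0 : w ≠ 0) : 8 ≤ w ⬝ᵥ w := by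
  obtain ⟨m, hm0, hm⟩ := dotProduct_self_eq w
  by_cases hc : modTwo w = 0
  · have hpos : 0 < w ⬝ᵥ w := by
      refine lt_of_le_of_ne (Finset.sum_nonneg fun i _ => mul_self_nonneg _) fun h => h0 ?_
      exact dotProduct_self_eq_zero.1 h.symm
    have h4 := four_dvd_dotProduct_self hw
    by_contra! hlt
    have h4 : w ⬝ᵥ w = 4 := by omega
    obtain ⟨v, rfl⟩ := exists_eq_two_smul (w := w) fun i => by
      have := congrFun hc i
      rw [modTwo_apply, Pi.zero_apply, ZMod.intCast_zmod_eq_zero_iff_dvd _ 2] at this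
      exact even_iff_two_dvd.2 this
    rw [smul_dotProduct, dotProduct_smul, smul_eq_mul, smul_eq_mul] at h4
    have h1 : v ⬝ᵥ v = 1 := by omega
    have h2 : (2 : ℤ) ∣ v ⬝ᵥ v - ∑ i, v i := by
      rw [dotProduct, ← Finset.sum_sub_distrib]
      refine Finset.dvd_sum fun i _ => ?_
      rw [← mul_sub_one]
      exact (Int.even_mul_pred_self (v i)).two_dvd
    have h3 : (4 : ℤ) ∣ 2 * ∑ i, v i := by
      simpa [Finset.mul_sum] using hw.2
    omega
  · have : (8 : ℤ) ≤ weight (modTwo w) := by exact_mod_cast eight_le_weight hw.1 hc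
    omega

/-- The lattice generated by twice the code vectors and a glue vector. -/
def glued (g : Fin 40 → ℤ) : Submodule ℤ (Fin 40 → ℤ) where
  carrier := {y | ∃ k : ℤ, ∃ w ∈ codeVectors, y = k • g + (2 : ℤ) • w}
  zero_mem' := ⟨0, 0, codeVectors.zero_mem, by simp⟩
  add_mem' := by
    rintro _ _ ⟨k, v, hv, rfl⟩ ⟨l, w, hw, rfl⟩
    exact ⟨k + l, v + w, codeVectors.add_mem hv hw, by module⟩
  smul_mem' := by
    rintro a _ ⟨k, v, hv, rfl⟩
    exact ⟨a * k, a • v, codeVectors.smul_mem a hv, by module⟩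

lemma four_dvd_dotProduct (hg : ∀ i, 4 ∣ g i - 1) (hw : w ∈ codeVectors) : 4 ∣ g ⬝ᵥ w := by
  have h : g ⬝ᵥ w = ∑ i, (g i - 1) * w i + ∑ i, w i := by
    rw [← Finset.sum_add_distrib]
    exact Finset.sum_congr rfl fun i _ => by ring
  rw [h]
  exact dvd_add (Finset.dvd_sum fun i _ => (hg i).mul_right _) hw.2

/-- Odd squares are 1 modulo 8, and there are 40 of them. -/
lemma eight_dvd_dotProduct_self (hg : ∀ i, 4 ∣ g i - 1) : 8 ∣ g ⬝ᵥ g := by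
  have h : g ⬝ᵥ g = ∑ i, (g i * g i - 1) + 40 := by
    simp [dotProduct]
  rw [h]
  refine dvd_add (Finset.dvd_sum fun i _ => ?_) (by norm_num)
  obtain ⟨m, hm⟩ := hg i
  exact ⟨2 * m ^ 2 + m, by rw [eq_add_of_sub_eq hm]; ring⟩

lemma glue_mem_codeVectors (hg : ∀ i, 4 ∣ g i - 1) : g ∈ codeVectors := by
  constructor
  · convert one_mem_code
    ext i
    obtain ⟨m, hm⟩ := hg i
    rw [modTwo_apply, eq_add_of_sub_eq hm, Pi.one_apply]
    push_cast
    rw [show (4 : ZMod 2) = 0 by decide]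
    ring
  · have h : ∑ i, g i = ∑ i, (g i - 1) + 40 := by simp
    rw [h]
    exact dvd_add (Finset.dvd_sum fun i _ => hg i) (by norm_num)

lemma eight_dvd_dotProduct (hg : ∀ i, 4 ∣ g i - 1) (hy : y ∈ glued g) (hz : z ∈ glued g) :
    8 ∣ y ⬝ᵥ z := by
  obtain ⟨k, v, hv, rfl⟩ := hy
  obtain ⟨l, w, hw, rfl⟩ := hz
  obtain ⟨a, ha⟩ := eight_dvd_dotProduct_self hg
  obtain ⟨b, hb⟩ := four_dvd_dotProduct hg hv
  obtain ⟨c, hc⟩ := four_dvd_dotProduct hg hw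
  obtain ⟨d, hd⟩ := two_dvd_dotProduct hv hw
  refine ⟨k * l * a + k * c + l * b + d, ?_⟩
  simp only [add_dotProduct, dotProduct_add, smul_dotProduct, dotProduct_smul, smul_eq_mul, ha, hc,
    hd, dotProduct_comm v g, hb]
  ring

/-- The parity of the multiple of g decides: 2g itself is twice a code vector, and g has odd
coordinates. -/
lemma glued_cases (hg : ∀ i, 4 ∣ g i - 1) (hy : y ∈ glued g) :
    (∃ w ∈ codeVectors, y = (2 : ℤ) • w) ∨ ∀ i, Odd (y i) := by
  obtain ⟨k, w, hw, rfl⟩ := hy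
  rcases Int.even_or_odd' k with ⟨m, rfl | rfl⟩
  · exact .inl ⟨m • g + w, codeVectors.add_mem
      (codeVectors.smul_mem m (glue_mem_codeVectors hg)) hw,
      by module⟩
  · refine .inr fun i => ?_
    obtain ⟨a, ha⟩ := hg i
    refine ⟨m * g i + w i + 2 * a, ?_⟩
    simp only [Pi.add_apply, Pi.smul_apply, smul_eq_mul]
    linear_combination ha

lemma two_smul_mem_glued (hw : w ∈ codeVectors) : (2 : ℤ) • w ∈ glued g := ⟨0, w, hw, by simp⟩

lemma two_smul_mem_glued_iff (hg : ∀ i, 4 ∣ g i - 1) :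
    (2 : ℤ) • w ∈ glued g ↔ w ∈ codeVectors := by
  refine ⟨fun h => ?_, two_smul_mem_glued⟩
  rcases glued_cases hg h with ⟨v, hv, h⟩ | h
  · rwa [smul_right_injective _ two_ne_zero h]
  · have := h 0
    rw [Pi.smul_apply, smul_eq_mul, Int.odd_iff] at this
    omega

lemma forty_le_dotProduct_self (hy : ∀ i, Odd (y i)) : 40 ≤ y ⬝ᵥ y := by
  have : ∑ _i : Fin 40, (1 : ℤ) ≤ y ⬝ᵥ y := by
    refine Finset.sum_le_sum fun i _ => ?_
    obtain ⟨m, hm⟩ := hy i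
    have : 0 < y i * y i := mul_self_pos.2 (by omega)
    omega
  simpa using this

lemma single_mem_codeVectors (i : Fin 40) : Pi.single i 4 ∈ codeVectors := by
  constructor
  · convert code.zero_mem
    ext j
    rw [modTwo_apply]
    rcases eq_or_ne j i with rfl | h
    · rw [Pi.single_eq_same]
      exact (by decide : ((4 : ℤ) : ZMod 2) = 0)
    · rw [Pi.single_eq_of_ne h]
      simp
  · simp

lemma single_sub_single_mem_codeVectors (i j : Fin 40) :
    Pi.single i 2 - Pi.single j 2 ∈ codeVectors := by
  constructor
  · convert code.zero_mem
    ext l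
    have h : ∀ k : Fin 40, modTwo (Pi.single k 2) l = 0 := by
      intro k
      rw [modTwo_apply]
      rcases eq_or_ne l k with rfl | h
      · rw [Pi.single_eq_same]
        decide
      · rw [Pi.single_eq_of_ne h]
        simp
    rw [map_sub, Pi.sub_apply, h, h]
    simp
  · simp

lemma exists_lift {c : Fin 40 → ZMod 2} (hc : c ∈ code) :
    (fun i => ((c i).val : ℤ)) ∈ codeVectors := by
  constructor
  · convert hc
    ext i
    simp [modTwo_apply]
  · rw [← Nat.cast_sum]
    exact Int.natCast_dvd_natCast.2 (four_dvd_weight hc)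

/-- Three kinds of test vectors suffice. Those of the form 2(2eᵢ - 2e₀) give all coordinates of z
the same parity, so z - z₀g = 2w. Twice the lifted codewords put w modulo 2 in the dual code, which
is contained in the code. Finally g itself gives the condition on the coordinate sum of w. -/
lemma mem_glued_of_dual (hg : ∀ i, 4 ∣ g i - 1) (h : ∀ y ∈ glued g, 8 ∣ z ⬝ᵥ y) : z ∈ glued g := by
  have hgg : g ∈ glued g := ⟨1, 0, codeVectors.zero_mem, by simp⟩
  have hpar : ∀ i, (2 : ℤ) ∣ z i - z 0 := by
    intro i
    have := h _ (two_smul_mem_glued (single_sub_single_mem_codeVectors i 0))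
    rw [dotProduct_smul, dotProduct_sub, dotProduct_single, dotProduct_single, smul_eq_mul] at this
    omega
  obtain ⟨w, hw⟩ : ∃ w, z - z 0 • g = (2 : ℤ) • w := by
    refine exists_eq_two_smul fun i => ?_
    obtain ⟨a, ha⟩ := hpar i
    obtain ⟨b, hb⟩ := hg i
    rw [even_iff_two_dvd]
    refine ⟨a - 2 * z 0 * b, ?_⟩
    simp only [Pi.sub_apply, Pi.smul_apply, smul_eq_mul]
    linear_combination ha - z 0 * hb
  have hdual : ∀ y ∈ glued g, 4 ∣ w ⬝ᵥ y := by
    intro y hy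
    have h1 : 8 ∣ (z - z 0 • g) ⬝ᵥ y := by
      rw [sub_dotProduct, smul_dotProduct]
      exact dvd_sub (h y hy) ((eight_dvd_dotProduct hg hgg hy).mul_left _)
    rw [hw, smul_dotProduct, smul_eq_mul] at h1
    omega
  refine ⟨z 0, w, ⟨mem_code_of_dual fun c hc => ?_, ?_⟩, by rw [← hw]; abel⟩
  · have h1 := hdual _ (two_smul_mem_glued (exists_lift hc))
    rw [dotProduct_smul, smul_eq_mul] at h1
    have h2 : ((2 : ℕ) : ℤ) ∣ w ⬝ᵥ fun i => ((c i).val : ℤ) := by omega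
    rw [← ZMod.intCast_zmod_eq_zero_iff_dvd _ 2] at h2
    simpa [dotProduct, modTwo_apply, mul_comm] using h2
  · have h1 := hdual g hgg
    have h2 : w ⬝ᵥ g = ∑ i, w i * (g i - 1) + ∑ i, w i := by
      rw [← Finset.sum_add_distrib]
      exact Finset.sum_congr rfl fun i _ => by ring
    rw [h2] at h1
    exact (dvd_add_right (Finset.dvd_sum fun i _ => (hg i).mul_left _)).1 h1

end CodeVectors

/-! ### The two lattices of dimension 40 -/

section CodeLattice

open Matrix

/-- Integer vectors, scaled by `1 / √8`. -/
def scaled : (Fin 40 → ℤ) →ₗ[ℤ] Euc 40 where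
  toFun y := WithLp.toLp 2 fun i => (y i : ℝ) / √8
  map_add' y z := by
    ext i
    simp [add_div]
  map_smul' k y := by
    ext i
    simp [mul_div_assoc]

lemma scaled_apply (y : Fin 40 → ℤ) (i : Fin 40) : scaled y i = y i / √8 := rfl

lemma inner_scaled (x : Euc 40) (y : Fin 40 → ℤ) :
    inner ℝ x (scaled y) = (∑ i, √8 * x i * y i) / 8 := by
  rw [PiLp.inner_apply, Finset.sum_div]
  refine Finset.sum_congr rfl fun i _ => ?_
  have h : √8 * √8 = (8 : ℝ) := Real.mul_self_sqrt (by norm_num)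
  have h0 : √8 ≠ (0 : ℝ) := by positivity
  rw [scaled_apply]
  simp only [RCLike.inner_apply, conj_trivial]
  field_simp
  linear_combination (-(x i) * y i) * h

lemma inner_scaled_scaled (y z : Fin 40 → ℤ) :
    inner ℝ (scaled y) (scaled z) = ((y ⬝ᵥ z : ℤ) : ℝ) / 8 := by
  rw [inner_scaled, dotProduct]
  push_cast
  congr 1
  refine Finset.sum_congr rfl fun i _ => ?_
  rw [scaled_apply, mul_div_cancel₀]
  positivity

lemma norm_scaled_sq (y : Fin 40 → ℤ) : ‖scaled y‖ ^ 2 = ((y ⬝ᵥ y : ℤ) : ℝ) / 8 := by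
  rw [← real_inner_self_eq_norm_sq, inner_scaled_scaled]

lemma scaled_injective : Function.Injective scaled := by
  intro y z h
  ext i
  have h1 := congrArg (fun x : Euc 40 => x i) h
  simp only [scaled_apply] at h1
  have h0 : √8 ≠ (0 : ℝ) := by positivity
  rw [div_left_inj' h0] at h1
  exact_mod_cast h1

/-- The lattice built from the code and a glue vector. -/
def codeLattice (g : Fin 40 → ℤ) : Submodule ℤ (Euc 40) := (glued g).map scaled

variable {g : Fin 40 → ℤ}

lemma norm_scaled_sq_eq {y : Fin 40 → ℤ} {k : ℕ} :
    ‖scaled y‖ ^ 2 = (k : ℝ) ↔ y ⬝ᵥ y = 8 * k := by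
  rw [norm_scaled_sq, div_eq_iff (by norm_num), ← Int.cast_inj (α := ℝ)]
  push_cast
  rw [mul_comm]

theorem isUnimodular_codeLattice (hg : ∀ i, 4 ∣ g i - 1) : IsUnimodular (codeLattice g) := by
  have hint : ∀ x ∈ codeLattice g, ∀ y ∈ codeLattice g, ∃ k : ℤ, inner ℝ x y = (k : ℝ) := by
    rintro _ ⟨y, hy, rfl⟩ _ ⟨z, hz, rfl⟩
    obtain ⟨k, hk⟩ := eight_dvd_dotProduct hg hy hz
    refine ⟨k, ?_⟩
    rw [inner_scaled_scaled, hk]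
    push_cast
    ring
  have hd : DiscreteTopology (codeLattice g) := by
    -- Norms are integers, so the open unit ball contains only the zero vector of the lattice.
    refine discreteTopology_of_isOpen_singleton_zero (Metric.isOpen_singleton_iff.2
      ⟨1, one_pos, fun x hx => ?_⟩)
    rw [dist_zero_right, Submodule.coe_norm] at hx
    obtain ⟨k, hk⟩ := hint x x.2 x x.2
    rw [real_inner_self_eq_norm_sq] at hk
    have h1 : (k : ℝ) < 1 := by
      rw [← hk]
      exact pow_lt_one₀ (norm_nonneg _) hx two_ne_zero
    have h2 : (0 : ℝ) ≤ k := by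
      rw [← hk]
      positivity
    have h3 : k = 0 := by
      have h1' : k < 1 := by exact_mod_cast h1
      have h2' : 0 ≤ k := by exact_mod_cast h2
      omega
    rw [h3, Int.cast_zero, sq_eq_zero_iff, norm_eq_zero] at hk
    exact Subtype.ext hk
  refine isUnimodular_of_selfDual hd ⟨?_⟩ hint fun x hx => ?_
  · rw [eq_top_iff, ← (EuclideanSpace.basisFun (Fin 40) ℝ).toBasis.span_eq, Submodule.span_le]
    rintro _ ⟨i, rfl⟩
    have hmem : scaled ((2 : ℤ) • Pi.single i 4) ∈ codeLattice g :=
      ⟨_, two_smul_mem_glued (single_mem_codeVectors i), rfl⟩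
    have h : (EuclideanSpace.basisFun (Fin 40) ℝ).toBasis i =
        (√8 / 8) • scaled ((2 : ℤ) • Pi.single i 4) := by
      ext j
      have h0 : √8 ≠ (0 : ℝ) := by positivity
      rw [OrthonormalBasis.coe_toBasis, EuclideanSpace.basisFun_apply, PiLp.smul_apply,
        scaled_apply]
      rcases eq_or_ne j i with rfl | hj
      · simp
        field_simp
        norm_num
      · simp [hj]
    rw [h]
    exact Submodule.smul_mem _ _ (Submodule.subset_span hmem)
  -- Pairing with 8eᵢ/√8 isolates √8 xᵢ, so x is a scaled integer vector.
  · have hz : ∀ i, ∃ k : ℤ, √8 * x i = k := by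
      intro i
      obtain ⟨k, hk⟩ := hx _ ⟨_, two_smul_mem_glued (single_mem_codeVectors i), rfl⟩
      refine ⟨k, ?_⟩
      rw [inner_scaled, Finset.sum_eq_single i] at hk
      · rw [← hk]
        simp
      · intro j _ hj
        simp [hj]
      · simp
    choose z hz using hz
    have hxz : x = scaled z := by
      ext i
      rw [scaled_apply, ← hz, mul_div_cancel_left₀]
      positivity
    refine ⟨z, mem_glued_of_dual hg fun y hy => ?_, hxz.symm⟩
    obtain ⟨k, hk⟩ := hx _ ⟨y, hy, rfl⟩
    refine ⟨k, ?_⟩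
    rw [hxz, inner_scaled_scaled, div_eq_iff (by norm_num)] at hk
    rw [mul_comm]
    exact_mod_cast hk

/-- In (kg + 2w)² the terms k²(g · g), 4k(g · w) and 4(w · w) are all divisible by 16, and the
scaling divides by 8. -/
lemma isEven_codeLattice (hg : ∀ i, 4 ∣ g i - 1) (h16 : 16 ∣ g ⬝ᵥ g) :
    IsEven (codeLattice g) := by
  rintro _ ⟨_, ⟨k, w, hw, rfl⟩, rfl⟩
  obtain ⟨a, ha⟩ := h16
  obtain ⟨b, hb⟩ := four_dvd_dotProduct hg hw
  obtain ⟨c, hc⟩ := four_dvd_dotProduct_self hw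
  refine ⟨k * k * a + k * b + c, ?_⟩
  have : (k • g + (2 : ℤ) • w) ⬝ᵥ (k • g + (2 : ℤ) • w) = 16 * (k * k * a + k * b + c) := by
    simp only [add_dotProduct, dotProduct_add, smul_dotProduct, dotProduct_smul, smul_eq_mul, ha,
      hc, dotProduct_comm w g, hb]
    ring
  rw [norm_scaled_sq, this]
  push_cast
  ring

/-- Vectors with odd coordinates have squared length at least 40/8 = 5, so below 5 only twice the
code vectors occur. The right-hand side does not involve g. -/
lemma setOf_norm_sq_eq (hg : ∀ i, 4 ∣ g i - 1) {k : ℕ} (hk : k < 5) :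
    {x : Euc 40 | x ∈ codeLattice g ∧ ‖x‖ ^ 2 = (k : ℝ)} =
      {x | ∃ w ∈ codeVectors, w ⬝ᵥ w = 2 * k ∧ scaled ((2 : ℤ) • w) = x} := by
  have h2 : ∀ w : Fin 40 → ℤ, ((2 : ℤ) • w) ⬝ᵥ ((2 : ℤ) • w) = 4 * (w ⬝ᵥ w) := by
    intro w
    rw [smul_dotProduct, dotProduct_smul, smul_eq_mul, smul_eq_mul]
    ring
  ext x
  constructor
  · rintro ⟨⟨y, hy, rfl⟩, hk⟩
    rw [norm_scaled_sq_eq] at hk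
    rcases glued_cases hg hy with ⟨w, hw, rfl⟩ | h
    · rw [h2] at hk
      exact ⟨w, hw, by omega, rfl⟩
    · have := forty_le_dotProduct_self h
      omega
  · rintro ⟨w, hw, hk, rfl⟩
    refine ⟨⟨_, two_smul_mem_glued hw, rfl⟩, ?_⟩
    rw [norm_scaled_sq_eq, h2, hk]
    ring

lemma normCount_codeLattice_eq_zero (hg : ∀ i, 4 ∣ g i - 1) {k : ℕ} (h0 : 0 < k) (hk : k < 4) :
    normCount (codeLattice g) k = 0 := by
  rw [normCount, setOf_norm_sq_eq hg (by omega), ← Set.ncard_empty (Euc 40)]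
  congr 1
  refine Set.eq_empty_of_forall_notMem ?_
  rintro x ⟨w, hw, hwk, -⟩
  have := eight_le_dotProduct_self hw (by
    rintro rfl
    rw [dotProduct_zero] at hwk
    omega)
  omega

lemma normCount_codeLattice_four {g' : Fin 40 → ℤ} (hg : ∀ i, 4 ∣ g i - 1)
    (hg' : ∀ i, 4 ∣ g' i - 1) : normCount (codeLattice g) 4 = normCount (codeLattice g') 4 := by
  rw [normCount, normCount, setOf_norm_sq_eq hg (by norm_num), setOf_norm_sq_eq hg' (by norm_num)]

lemma normCount_codeLattice_four_ne_zero (hg : ∀ i, 4 ∣ g i - 1) :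
    normCount (codeLattice g) 4 ≠ 0 := by
  have hd := (isUnimodular_codeLattice hg).discrete
  refine ((Set.ncard_pos (finite_norm_sq_eq _ _)).2 ?_).ne'
  rw [setOf_norm_sq_eq hg (by norm_num)]
  -- The witness is 2e₀ + 2e₁, of squared length 8 before scaling.
  refine ⟨_, Pi.single 0 4 + (Pi.single 1 2 - Pi.single 0 2), codeVectors.add_mem
    (single_mem_codeVectors 0) (single_sub_single_mem_codeVectors 1 0), ?_, rfl⟩
  simp

lemma minNorm_codeLattice (hg : ∀ i, 4 ∣ g i - 1) : minNorm (codeLattice g) = 4 := by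
  exact_mod_cast (isUnimodular_codeLattice hg).minNorm_eq (m := 4) (by norm_num)
    (fun k => normCount_codeLattice_eq_zero hg) (normCount_codeLattice_four_ne_zero hg)

lemma normCount_codeLattice_one_five : normCount (codeLattice 1) 5 = 2 ^ 20 := by
  have h1 : ∀ i, (4 : ℤ) ∣ (1 : Fin 40 → ℤ) i - 1 := by simp
  let f : (Fin 40 → ZMod 2) → Euc 40 := fun c =>
    scaled (1 - (2 : ℤ) • fun i => ((c i).val : ℤ))
  have hf : Function.Injective f := by
    intro c c' h
    have h2 := smul_right_injective (Fin 40 → ℤ) (two_ne_zero' ℤ) (sub_right_injective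
      (scaled_injective h))
    ext i
    have h3 := congrFun h2 i
    exact ZMod.val_injective 2 (Int.natCast_inj.1 h3)
  have hone : (1 : Fin 40 → ℤ) ∈ glued 1 := ⟨1, 0, codeVectors.zero_mem, by simp⟩
  -- Norm 5 means y · y = 40. This excludes twice a code vector, where y · y is divisible by 16, and
  -- forces all coordinates to be ±1; the positions of -1 form a codeword.
  have hset : {x : Euc 40 | x ∈ codeLattice 1 ∧ ‖x‖ ^ 2 = ((5 : ℕ) : ℝ)} = f '' code := by
    ext x
    constructor
    · rintro ⟨⟨y, hy, rfl⟩, h5⟩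
      rw [norm_scaled_sq_eq] at h5
      rcases glued_cases h1 hy with ⟨w, hw, rfl⟩ | h
      · have := four_dvd_dotProduct_self hw
        rw [smul_dotProduct, dotProduct_smul, smul_eq_mul, smul_eq_mul] at h5
        omega
      · have hpos : ∀ i, 0 ≤ y i * y i - 1 := by
          intro i
          have : 0 < y i * y i := mul_self_pos.2 fun h0 => by simpa [h0] using h i
          omega
        have hsum : ∑ i, (y i * y i - 1) = 0 := by
          rw [Finset.sum_sub_distrib, ← dotProduct, h5]
          simp
        have hone' : ∀ i, y i = 1 ∨ y i = -1 := by
          intro i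
          have := (Finset.sum_eq_zero_iff_of_nonneg fun i _ => hpos i).1 hsum i (Finset.mem_univ i)
          exact mul_self_eq_one_iff.1 (by omega)
        set c : Fin 40 → ZMod 2 := fun i => if y i = 1 then 0 else 1
        have hyc : y = 1 - (2 : ℤ) • fun i => ((c i).val : ℤ) := by
          ext i
          change y i = 1 - 2 * ((c i).val : ℤ)
          rcases hone' i with hi | hi
          · rw [show c i = 0 by simp [c, hi], hi]
            rfl
          · rw [show c i = 1 by simp [c, hi], hi]
            rfl
        refine ⟨c, ?_, by rw [hyc]⟩
        have h2 : (2 : ℤ) • (fun i => ((c i).val : ℤ)) ∈ glued 1 := by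
          rw [show (2 : ℤ) • (fun i => ((c i).val : ℤ)) = 1 - y by rw [hyc]; abel]
          exact (glued 1).sub_mem hone hy
        have h3 := ((two_smul_mem_glued_iff h1).1 h2).1
        rwa [show (modTwo fun i => ((c i).val : ℤ)) = c by ext i; simp [modTwo_apply]] at h3
    · rintro ⟨c, hc, rfl⟩
      refine ⟨⟨_, (glued 1).sub_mem hone (two_smul_mem_glued (exists_lift hc)), rfl⟩, ?_⟩
      rw [norm_scaled_sq_eq]
      have h : ∀ a : ZMod 2, (1 - 2 * (a.val : ℤ)) * (1 - 2 * (a.val : ℤ)) = 1 := by decide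
      refine (Finset.sum_congr rfl fun i _ => h (c i)).trans ?_
      simp
  rw [normCount, hset, Set.ncard_image_of_injective _ hf, ncard_code]

/-- The glue vector of the even lattice. -/
def evenGlue : Fin 40 → ℤ := 1 - Pi.single 0 4

lemma four_dvd_evenGlue (i : Fin 40) : 4 ∣ evenGlue i - 1 := by
  rcases eq_or_ne i 0 with rfl | h
  · simp [evenGlue]
  · simp [evenGlue, h]

lemma four_dvd_one_sub (i : Fin 40) : 4 ∣ (1 : Fin 40 → ℤ) i - 1 := by simp

theorem isExtremalEven_codeLattice : IsExtremalEven (codeLattice evenGlue) := by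
  -- The glue vector (-3, 1, …, 1) has squared length 9 + 39 = 48 = 16 · 3.
  refine ⟨⟨isUnimodular_codeLattice four_dvd_evenGlue,
    isEven_codeLattice four_dvd_evenGlue ⟨3, ?_⟩⟩, ?_⟩
  · simp only [evenGlue, sub_dotProduct, dotProduct_sub, single_dotProduct, dotProduct_single]
    simp
  · rw [minNorm_codeLattice four_dvd_evenGlue]
    norm_num

theorem isOddUnimodular_codeLattice : IsOddUnimodular (codeLattice 1) := by
  refine ⟨isUnimodular_codeLattice four_dvd_one_sub, fun h => ?_⟩
  have := (isUnimodular_codeLattice four_dvd_one_sub).discrete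
  have h5 := h.normCount_odd (k := 5) (by decide)
  rw [normCount_codeLattice_one_five] at h5
  norm_num at h5

lemma thetaSeries_coeff {n : ℕ} (Λ : Submodule ℤ (Euc n)) (k : ℕ) :
    (thetaSeries Λ).coeff k = normCount Λ k := PowerSeries.coeff_mk _ _

lemma trunc_thetaSeries_iff {n : ℕ} {Λ : Submodule ℤ (Euc n)} :
    PowerSeries.trunc 6 (thetaSeries Λ) =
      1 + 39600 * Polynomial.X ^ 4 + 1048576 * Polynomial.X ^ 5 ↔
    normCount Λ 1 = 0 ∧ normCount Λ 2 = 0 ∧ normCount Λ 3 = 0 ∧ normCount Λ 4 = 39600 ∧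
      normCount Λ 5 = 1048576 := by
  have hp : (1 + 39600 * Polynomial.X ^ 4 + 1048576 * Polynomial.X ^ 5 : Polynomial ℤ) =
      Polynomial.C 1 + Polynomial.C 39600 * Polynomial.X ^ 4 +
        Polynomial.C 1048576 * Polynomial.X ^ 5 := by simp
  rw [hp]
  constructor
  · intro h
    have hc : ∀ k < 6, (normCount Λ k : ℤ) = _ := fun k hk => by
      have := congrArg (Polynomial.coeff · k) h
      simp only [PowerSeries.coeff_trunc, hk, if_true, thetaSeries_coeff, Polynomial.coeff_add,
        Polynomial.coeff_C, Polynomial.coeff_C_mul, Polynomial.coeff_X_pow] at this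
      exact this
    refine ⟨?_, ?_, ?_, ?_, ?_⟩
    · simpa using hc 1 (by norm_num)
    · simpa using hc 2 (by norm_num)
    · simpa using hc 3 (by norm_num)
    · have := hc 4 (by norm_num)
      norm_num at this
      exact_mod_cast this
    · have := hc 5 (by norm_num)
      norm_num at this
      exact_mod_cast this
  · rintro ⟨h1, h2, h3, h4, h5⟩
    ext k
    simp only [PowerSeries.coeff_trunc, thetaSeries_coeff, Polynomial.coeff_add,
        Polynomial.coeff_C, Polynomial.coeff_C_mul, Polynomial.coeff_X_pow]
    rcases lt_or_ge k 6 with hk | hk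
    · interval_cases k <;> simp [normCount_zero, h1, h2, h3, h4, h5]
    · rw [if_neg (by omega), if_neg (by omega), if_neg (by omega), if_neg (by omega)]
      simp

/-- No direct enumeration is needed: modularity fixes the count for the even lattice, and vectors of
norm 4 do not depend on the glue. -/
theorem normCount_codeLattice_eq (hg : ∀ i, 4 ∣ g i - 1) : normCount (codeLattice g) 4 = 39600 := by
  rw [normCount_codeLattice_four hg four_dvd_evenGlue,
    ← isExtremalEven_codeLattice.kissingNumber_eq]
  exact (kissingNumber_eq (m := 4) (by norm_num)
    (by exact_mod_cast minNorm_codeLattice four_dvd_evenGlue)).symm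

lemma trunc_thetaSeries_codeLattice :
    PowerSeries.trunc 6 (thetaSeries (codeLattice 1)) =
      1 + 39600 * Polynomial.X ^ 4 + 1048576 * Polynomial.X ^ 5 := by
  have h := four_dvd_one_sub
  exact trunc_thetaSeries_iff.2 ⟨normCount_codeLattice_eq_zero h (by norm_num) (by norm_num),
    normCount_codeLattice_eq_zero h (by norm_num) (by norm_num),
    normCount_codeLattice_eq_zero h (by norm_num) (by norm_num), normCount_codeLattice_eq h,
    normCount_codeLattice_one_five⟩

end CodeLattice

end SecrecyGain

end

/-! ### The main theorem -/

open SecrecyGain in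
theorem mainTheorem5 :
    (∀ Λ : Submodule ℤ (Euc 40), IsExtremalEven Λ →
      (∀ τ : UpperHalfPlane, theta Λ (τ : ℂ) =
        ModularForm.E₄ τ ^ 5
          - 1200 * ModularForm.E₄ τ ^ 2 * ModularForm.discriminant τ) ∧
      minNorm Λ = 4 ∧ kissingNumber Λ = 39600 ∧
      IsMaxOn (secrecyFunction Λ) (Set.Ioi 0) 1 ∧ secrecyGain Λ = 4096 / 297) ∧
    (∀ Λ : Submodule ℤ (Euc 40), IsOddUnimodular Λ →
      PowerSeries.trunc 6 (thetaSeries Λ) =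
        1 + 39600 * Polynomial.X ^ 4 + 1048576 * Polynomial.X ^ 5 →
      minNorm Λ = 4 ∧ kissingNumber Λ = 39600 ∧
      IsMaxOn (secrecyFunction Λ) (Set.Ioi 0) 1 ∧ secrecyGain Λ = 4096 / 301) ∧
    (∃ Λ₁ Λ₂ : Submodule ℤ (Euc 40),
      IsExtremalEven Λ₁ ∧
      (IsOddUnimodular Λ₂ ∧
        PowerSeries.trunc 6 (thetaSeries Λ₂) =
          1 + 39600 * Polynomial.X ^ 4 + 1048576 * Polynomial.X ^ 5) ∧
      minNorm Λ₁ = minNorm Λ₂ ∧ kissingNumber Λ₁ = kissingNumber Λ₂ ∧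
      secrecyGain Λ₁ ≠ secrecyGain Λ₂) := by
  have even : ∀ Λ : Submodule ℤ (Euc 40), IsExtremalEven Λ →
      (∀ τ : UpperHalfPlane, theta Λ (τ : ℂ) =
        ModularForm.E₄ τ ^ 5
          - 1200 * ModularForm.E₄ τ ^ 2 * ModularForm.discriminant τ) ∧
      minNorm Λ = 4 ∧ kissingNumber Λ = 39600 ∧
      IsMaxOn (secrecyFunction Λ) (Set.Ioi 0) 1 ∧ secrecyGain Λ = 4096 / 297 := by
    intro Λ hΛ
    -- The even theta function has no (θ₂θ₄)²⁰ term.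
    have h := secrecyFunction_max (c := 0) le_rfl zero_le_one (Λ := Λ) fun τ => by
      rw [hΛ.thetaFn_eq]
      simp
    refine ⟨fun τ => ?_, hΛ.minNorm_eq, hΛ.kissingNumber_eq, h.1, h.2.trans (by norm_num)⟩
    rw [← extremalForm_apply, ← hΛ.thetaFn_eq]
    rfl
  have odd : ∀ Λ : Submodule ℤ (Euc 40), IsOddUnimodular Λ →
      PowerSeries.trunc 6 (thetaSeries Λ) =
        1 + 39600 * Polynomial.X ^ 4 + 1048576 * Polynomial.X ^ 5 →
      minNorm Λ = 4 ∧ kissingNumber Λ = 39600 ∧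
      IsMaxOn (secrecyFunction Λ) (Set.Ioi 0) 1 ∧ secrecyGain Λ = 4096 / 301 := by
    intro Λ hΛ ht
    obtain ⟨h1, h2, h3, h4, h5⟩ := trunc_thetaSeries_iff.1 ht
    have hmin : minNorm Λ = (4 : ℕ) := by
      refine hΛ.1.minNorm_eq (by norm_num) (fun k hk0 hk => ?_) (by rw [h4]; norm_num)
      interval_cases k <;> assumption
    -- The odd theta function contains (θ₂θ₄)²⁰ with coefficient 1, which raises 297 to 301.
    have h := secrecyFunction_max (c := 1) zero_le_one le_rfl (Λ := Λ) fun τ => by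
      rw [hΛ.1.thetaFn_eq h1 h2 h3 h4 h5]
      simp
    exact ⟨by exact_mod_cast hmin, (kissingNumber_eq (by norm_num) hmin).trans h4, h.1,
      h.2.trans (by norm_num)⟩
  refine ⟨even, odd, codeLattice evenGlue, codeLattice 1, isExtremalEven_codeLattice,
    ⟨isOddUnimodular_codeLattice, trunc_thetaSeries_codeLattice⟩, ?_⟩
  obtain ⟨-, m1, k1, -, s1⟩ := even _ isExtremalEven_codeLattice
  obtain ⟨m2, k2, -, s2⟩ := odd _ isOddUnimodular_codeLattice trunc_thetaSeries_codeLattice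
  exact ⟨m1.trans m2.symm, k1.trans k2.symm, by rw [s1, s2]; norm_num⟩
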